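/- Let $n,k$ be integers with $1\le k<n+1$, put $Q=2n+2$ and $p=\frac{2Q}{Q-2k}$, and let $S^{2n+1}\subset\mathbb{C}^{n+1}$ be the unit sphere with its standard CR structure, the contact form $\theta_0=\frac i2\sum_{j=1}^{n+1}(z_j\,d\bar z_j-\bar z_j\,dz_j)$, the volume element $d\xi=\theta_0\wedge(d\theta_0)^n$ (that is, $2^n n!$ times the surface measure) and the Reeb field $T=i\sum_j(z_j\partial_{z_j}-\bar z_j\partial_{\bar z_j})$. With $Z_{jl}=\bar z_j\partial_{z_l}-\bar z_l\partial_{z_j}$ (these fields span $T^{1,0}S^{2n+1}$), let $\Delta_b=-\sum_{j<l}(Z_{jl}\bar Z_{jl}+\bar Z_{jl}Z_{jl})$ be the sub-Laplacian, and let $$P_k=\prod_{j=0}^{k-1}L_{k-2j-1},\qquad L_\mu=\tfrac12\Delta_b+\tfrac i2\mu T+\tfrac14(n-\mu)(n+\mu),$$ be the CR GJMS operator of order $2k$ of $(S^{2n+1},\theta_0)$. Let $S^{k,2}(S^{2n+1})$ be the Folland--Stein space, the closure of $C^\infty(S^{2n+1};\mathbb{C})$ in the norm $\sum\|X_1\cdots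 X_mF\|_{L^2}$, where the sum is over all $m\le k$ and all choices of $X_1,\dots,X_m$ among the fields $Z_{jl},\bar Z_{jl}$. For $F,G\in S^{k,2}(S^{2n+1})$ the expression $\int G\,P_kF\,d\xi$ denotes the continuous extension to $S^{k,2}\times S^{k,2}$ of the bilinear form $(\varphi,\psi)\mapsto\int\psi\,P_k\varphi\,d\xi$ on smooth functions, and for smooth $a$ $$\int G\,[P_k,a](F)\,d\xi:=\int G\,P_k(aF)\,d\xi-\int aG\,P_kF\,d\xi .$$ Let $u\in S^{k,2}(S^{2n+1};\mathbb{R})$ be positive almost everywhere and a local minimizer of $$Y_k(S^{2n+1})=\inf\Big\{\int v\,P_kv\,d\xi\;:\;v\in S^{k,2}(S^{2n+1};\mathbb{R}),\ \int|v|^p\,d\xi=1\Big\};$$ that is, $\int u^p\,d\xi=1$, and there is $\varepsilon>0$ such that $\int u\,P_ku\,d\xi\le\int v\,P_kv\,d\xi$ for all real-valued $v\in S^{k,2}(S^{2n+1})$ with $\int|v|^p\,d\xi=1$ and $\|v-u\|_{S^{k,2}}<\varepsilon$. (In particular, this holds if $u$ is a local minimizer among complex-valued functions.) Suppose in addition that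 $$\int_{S^{2n+1}}z_j\,u^p\,d\xi=0,\qquad j=1,\dots,n+1 .$$ Then $\sum_{j}\int\bar z_ju\,[P_k,z_j](u)\,d\xi$ and $\int u\,P_k(u)\,d\xi$ are real numbers, and $$\sum_{j=1}^{n+1}\int_{S^{2n+1}}\bar z_j\,u\,[P_k,z_j](u)\,d\xi\;\ge\;(p-2)\int_{S^{2n+1}}u\,P_k(u)\,d\xi .$$ -/

import Mathlib

open MeasureTheory Filter Topology
open scoped ENNReal ContDiff

noncomputable section

namespace CRSphere

/-- `ℂ^{n+1}` with its Hermitian norm. -/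
abbrev Amb (n : ℕ) : Type := EuclideanSpace ℂ (Fin (n + 1))

/-- The unit sphere `S^{2n+1} ⊆ ℂ^{n+1}`. -/
abbrev Sph (n : ℕ) : Type := Metric.sphere (0 : Amb n) 1

/-- The coordinate function `z_j` on the sphere. -/
def coord {n : ℕ} (j : Fin (n + 1)) (ξ : Sph n) : ℂ := (ξ : Amb n) j

/-- The volume element `dξ = θ₀ ∧ (dθ₀)^n` of the contact form
`θ₀ = (i/2) ∑ (z_j dz̄_j - z̄_j dz_j) = ∑ (x_j dy_j - y_j dx_j)`. Since `dθ₀ = 2 ∑ dx_j ∧ dy_j`,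
it is `2^n n!` times the surface measure of the unit sphere. -/
def vol (n : ℕ) : Measure (Sph n) :=
  ((2 ^ n * n.factorial : ℕ) : ℝ≥0∞) • (volume : Measure (Amb n)).toSphere

/-- The extension of a function on the sphere to `ℂ^{n+1} \ {0}` that is constant on rays
(the value at the origin plays no role). -/
def radialExt {n : ℕ} (f : Sph n → ℂ) (z : Amb n) : ℂ :=
  if h : z = 0 then 0
  else f ⟨((‖z‖⁻¹ : ℝ) : ℂ) • z, by
    rw [mem_sphere_zero_iff_norm, norm_smul, Complex.norm_real, norm_inv, norm_norm]
    exact inv_mul_cancel₀ (norm_ne_zero_iff.mpr h)⟩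

/-- `f ∈ C^∞(S^{2n+1}; ℂ)`. -/
def IsSmooth {n : ℕ} (f : Sph n → ℂ) : Prop :=
  ContDiffOn ℝ ∞ (radialExt f) {0}ᶜ

/-- The derivative of `f` at `ξ` in the direction of the real tangent vector `v`. -/
def dirDeriv {n : ℕ} (f : Sph n → ℂ) (ξ : Sph n) (v : Amb n) : ℂ :=
  fderiv ℝ (radialExt f) (ξ : Amb n) v

/-- The coefficient vector `z̄_j e_l - z̄_l e_j` of the vector field
`Z_{jl} = z̄_j ∂_{z_l} - z̄_l ∂_{z_j}`. -/
def horizVec {n : ℕ} (j l : Fin (n + 1)) (ξ : Sph n) : Amb n :=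
  EuclideanSpace.single l (star (coord j ξ)) - EuclideanSpace.single j (star (coord l ξ))

/-- `Z_{jl} f`, where `Z_{jl} = z̄_j ∂_{z_l} - z̄_l ∂_{z_j}`. These tangential fields span the CR
structure `T^{1,0} S^{2n+1}` at every point. For a coefficient vector `a`, one has
`∑ a_m ∂_{z_m} f = (df(a) - i df(i a)) / 2`. -/
def Z {n : ℕ} (j l : Fin (n + 1)) (f : Sph n → ℂ) (ξ : Sph n) : ℂ :=
  (dirDeriv f ξ (horizVec j l ξ) - Complex.I * dirDeriv f ξ (Complex.I • horizVec j l ξ)) / 2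

/-- `Z̄_{jl} f`, where `Z̄_{jl} = z_j ∂_{z̄_l} - z_l ∂_{z̄_j}` is the conjugate of `Z_{jl}`. -/
def Zbar {n : ℕ} (j l : Fin (n + 1)) (f : Sph n → ℂ) (ξ : Sph n) : ℂ :=
  (dirDeriv f ξ (horizVec j l ξ) + Complex.I * dirDeriv f ξ (Complex.I • horizVec j l ξ)) / 2

/-- The Reeb field `T = i ∑ (z_j ∂_{z_j} - z̄_j ∂_{z̄_j})` of `θ₀`, i.e. the derivative in the
direction `i ξ`. -/
def reeb {n : ℕ} (f : Sph n → ℂ) (ξ : Sph n) : ℂ :=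
  dirDeriv f ξ (Complex.I • (ξ : Amb n))

/-- The (nonnegative) sub-Laplacian of `θ₀`,
`Δ_b = -∑_α (Z_α Z̄_α + Z̄_α Z_α) = -∑_{j<l} (Z_{jl} Z̄_{jl} + Z̄_{jl} Z_{jl})`
(`Z_α` a local unitary frame of `T^{1,0}`). The sum below runs over all ordered pairs, whence the
factor `1/2`. -/
def subLaplacian {n : ℕ} (f : Sph n → ℂ) (ξ : Sph n) : ℂ :=
  -(1 / 2) * ∑ j : Fin (n + 1), ∑ l : Fin (n + 1),
    (Z j l (Zbar j l f) ξ + Zbar j l (Z j l f) ξ)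

/-- `L_μ = (1/2) Δ_b + (i/2) μ T + (1/4) (n - μ) (n + μ)`. -/
def Lop {n : ℕ} (μ : ℝ) (f : Sph n → ℂ) (ξ : Sph n) : ℂ :=
  1 / 2 * subLaplacian f ξ + Complex.I / 2 * μ * reeb f ξ
    + 1 / 4 * ((n : ℂ) - μ) * ((n : ℂ) + μ) * f ξ

/-- The CR GJMS operator of order `2k` of `(S^{2n+1}, θ₀)`,
`P_k = ∏_{j=0}^{k-1} L_{k-2j-1}`, acting on smooth functions. -/
def gjms {n : ℕ} (k : ℕ) (f : Sph n → ℂ) : Sph n → ℂ :=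
  (List.range k).foldr (fun j g => Lop ((k : ℝ) - 2 * j - 1) g) f

/-- Labels of the horizontal fields `Z_{jl}` (`false`) and `Z̄_{jl}` (`true`). -/
abbrev Label (n : ℕ) : Type := Fin (n + 1) × Fin (n + 1) × Bool

/-- The horizontal field with a given label. -/
def horiz {n : ℕ} (a : Label n) (f : Sph n → ℂ) : Sph n → ℂ :=
  if a.2.2 then Zbar a.1 a.2.1 f else Z a.1 a.2.1 f

/-- `X_{a_1} ⋯ X_{a_m} f` for a word `a_1 ⋯ a_m` of horizontal fields. -/
def horizWord {n : ℕ} (w : List (Label n)) (f : Sph n → ℂ) : Sph n → ℂ :=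
  w.foldr horiz f

/-- `G ∈ L²` is the weak derivative `X_{a_1} ⋯ X_{a_m} F` of `F ∈ L²`. All the fields are
divergence free for `dξ`, so the formal transpose of `X_{a_1} ⋯ X_{a_m}` is
`(-1)^m X_{a_m} ⋯ X_{a_1}`. -/
def IsWeakDeriv {n : ℕ} (w : List (Label n)) (F G : Sph n → ℂ) : Prop :=
  MemLp F 2 (vol n) ∧ MemLp G 2 (vol n) ∧
    ∀ φ : Sph n → ℂ, IsSmooth φ →
      ∫ ξ, G ξ * φ ξ ∂(vol n) = (-1) ^ w.length * ∫ ξ, F ξ * horizWord w.reverse φ ξ ∂(vol n)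

/-- The Folland–Stein norm `‖F‖_{S^{k,2}} = ∑_{m ≤ k} ∑_{a_1, …, a_m} ‖X_{a_1} ⋯ X_{a_m} F‖_{L²}`,
with weak derivatives. It is `∞` if one of them does not exist in `L²`; the infimum is over the
(almost everywhere unique) weak derivatives. -/
def fsNorm {n : ℕ} (k : ℕ) (F : Sph n → ℂ) : ℝ≥0∞ :=
  ∑ m ∈ Finset.range (k + 1), ∑ a : Fin m → Label n,
    ⨅ (G : Sph n → ℂ) (_ : IsWeakDeriv (List.ofFn a) F G), eLpNorm G 2 (vol n)

/-- `F ∈ S^{k,2}(S^{2n+1})`, the closure of `C^∞` for the Folland–Stein norm. -/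
def MemFS {n : ℕ} (k : ℕ) (F : Sph n → ℂ) : Prop :=
  ∀ ε : ℝ≥0∞, 0 < ε → ∃ φ : Sph n → ℂ, IsSmooth φ ∧ fsNorm k (φ - F) < ε

/-- Smooth functions converging to `F` in `S^{k,2}`. -/
def smoothNhds {n : ℕ} (k : ℕ) (F : Sph n → ℂ) : Filter (Sph n → ℂ) :=
  ⨅ (ε : ℝ≥0∞) (_ : 0 < ε), 𝓟 {φ | IsSmooth φ ∧ fsNorm k (φ - F) < ε}

/-- `⟨P_k F, G⟩ = ∫ G P_k F dξ` for `F, G ∈ S^{k,2}`: the continuous extension to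
`S^{k,2} × S^{k,2}` of the bilinear form `(φ, ψ) ↦ ∫ ψ P_k φ dξ` on smooth functions.
In other words, `P_k F` is taken in the dual of `S^{k,2}`. -/
def gjmsPairing {n : ℕ} (k : ℕ) (F G : Sph n → ℂ) : ℂ :=
  limUnder (smoothNhds k F ×ˢ smoothNhds k G)
    fun q : (Sph n → ℂ) × (Sph n → ℂ) => ∫ ξ, q.2 ξ * gjms k q.1 ξ ∂(vol n)

/-- `∫ G [P_k, a] F dξ` for a smooth function `a`, where `[P_k, a] F = P_k (a F) - a P_k F`. -/
def commPairing {n : ℕ} (k : ℕ) (a F G : Sph n → ℂ) : ℂ :=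
  gjmsPairing k (a * F) G - gjmsPairing k F (a * G)

/-- `p = 2Q / (Q - 2k)` with `Q = 2n + 2`. -/
def critExp (n k : ℕ) : ℝ := 2 * (2 * n + 2) / ((2 * n + 2) - 2 * k)

/-- A real-valued function regarded as a complex-valued one. -/
def toC {n : ℕ} (u : Sph n → ℝ) (ξ : Sph n) : ℂ := (u ξ : ℂ)

/-- `A_k(u) = ∫ u P_k u dξ` for real-valued `u ∈ S^{k,2}` (a real number, as `P_k` is formally
self-adjoint). -/
def energy {n : ℕ} (k : ℕ) (u : Sph n → ℝ) : ℝ := (gjmsPairing k (toC u) (toC u)).re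

/-- `B_k(u) = ∫ |u|^p dξ`. -/
def constraint {n : ℕ} (k : ℕ) (u : Sph n → ℝ) : ℝ := ∫ ξ, |u ξ| ^ critExp n k ∂(vol n)

/-- `u` is a local minimizer of `Y_k(S^{2n+1})`: it minimizes `A_k` among the real-valued
`v ∈ S^{k,2}` with `B_k(v) = 1` that are close to `u` in `S^{k,2}`, and `B_k(u) = 1`. -/
def IsLocalMinimizer {n : ℕ} (k : ℕ) (u : Sph n → ℝ) : Prop :=
  MemFS k (toC u) ∧ constraint k u = 1 ∧
    ∃ ε : ℝ≥0∞, 0 < ε ∧ ∀ v : Sph n → ℝ, MemFS k (toC v) → constraint k v = 1 →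
      fsNorm k (toC v - toC u) < ε → energy k u ≤ energy k v

end CRSphere

end

noncomputable section

namespace CRSphere

variable {n : ℕ}

/-! ### Smooth functions on the sphere -/

/-! Write A(v) = ∫ v P_k v. The direction fu, with f real, smooth, |f| ≤ 1 and ∫ f u^p = 0, leaves
the constraint unchanged to first order. Minimality along the normalized curve (1 + tf)u gives (p -
1) (∫ f² u^p) A(u) ≤ A(fu), which is `IsLocalMinimizer.second_variation`. The balancing condition
allows f = Re z_j and f = Im z_j. Since ∑ |z_j|² = 1, summing gives (p - 1) A(u) ≤ ∑ (A(Re z_j · u)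
+ A(Im z_j · u)) (`IsLocalMinimizer.sum_energy_ge`). Because the pairing is symmetric and bilinear,
the right side is ∑ ⟨P_k(z_j u), z̄_j u⟩, and ∑ z_j z̄_j u = u turns the commutator sum into this
quantity minus A(u) (`sum_commPairing`). Reality holds because P_k commutes with complex
conjugation.

Most of the work makes the pairing on S^{k,2} usable. The form ∫ ψ P_k φ is bounded in the
Folland–Stein norms (`gjmsForm_bound`): the Reeb field is a sum of commutators of horizontal fields,
so P_k is a combination of horizontal words of length at most 2k, and up to k letters of each can be
integrated by parts onto ψ. Hence the limit defining the pairing exists (`tendsto_gjmsPairing`), and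
its algebra is inherited from smooth functions. Multiplication by a smooth function preserves
S^{k,2} (`fsNorm_smooth_mul_le`), so fu is admissible.

No Sobolev embedding is needed: for bounded f the constraint along the curve is ∫ |1 + tf|^p |u|^p,
whose expansion only requires |u|^p to be integrable. -/

theorem Sph.coe_ne_zero (ξ : Sph n) : (ξ : Amb n) ≠ 0 := by
  intro h
  have := mem_sphere_zero_iff_norm.mp ξ.2
  rw [h, norm_zero] at this
  exact zero_ne_one this

theorem radialExt_coe (f : Sph n → ℂ) (ξ : Sph n) : radialExt f ξ = f ξ := by
  rw [radialExt, dif_neg ξ.coe_ne_zero]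
  congr 1
  ext1
  simp

theorem radialExt_eq_of_smul (f : Sph n → ℂ) {z : Amb n} {ξ : Sph n} {r : ℝ} (hr : 0 < r)
    (h : z = r • (ξ : Amb n)) : radialExt f z = f ξ := by
  have hξ : ‖(ξ : Amb n)‖ = 1 := mem_sphere_zero_iff_norm.mp ξ.2
  have hn : ‖z‖ = r := by rw [h, norm_smul, hξ, mul_one, Real.norm_of_nonneg hr.le]
  have hz : z ≠ 0 := by
    rw [← norm_ne_zero_iff, hn]
    exact hr.ne'
  rw [radialExt, dif_neg hz]
  congr 1
  ext1
  change ((‖z‖⁻¹ : ℝ) : ℂ) • z = ξ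
  rw [hn, h, Complex.coe_smul, smul_smul, inv_mul_cancel₀ hr.ne', one_smul]

theorem exists_eq_smul_sph {z : Amb n} (hz : z ≠ 0) :
    ∃ ξ : Sph n, z = ‖z‖ • (ξ : Amb n) := by
  refine ⟨⟨‖z‖⁻¹ • z, ?_⟩, ?_⟩
  · rw [mem_sphere_zero_iff_norm, norm_smul, norm_inv, norm_norm]
    exact inv_mul_cancel₀ (norm_ne_zero_iff.mpr hz)
  · rw [smul_smul, mul_inv_cancel₀ (norm_ne_zero_iff.mpr hz), one_smul]

theorem radialExt_smul (f : Sph n → ℂ) {z : Amb n} {r : ℝ} (hr : 0 < r) :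
    radialExt f (r • z) = radialExt f z := by
  by_cases hz : z = 0
  · rw [hz, smul_zero]
  · obtain ⟨ξ, hξ⟩ := exists_eq_smul_sph hz
    have hz' : 0 < ‖z‖ := norm_pos_iff.mpr hz
    rw [radialExt_eq_of_smul f hz' hξ]
    refine radialExt_eq_of_smul f (mul_pos hr hz') ?_
    rw [mul_smul, ← hξ]

theorem radialExt_add (f g : Sph n → ℂ) : radialExt (f + g) = radialExt f + radialExt g := by
  ext z
  by_cases hz : z = 0 <;> simp [radialExt, hz]

theorem radialExt_mul (f g : Sph n → ℂ) : radialExt (f * g) = radialExt f * radialExt g := by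
  ext z
  by_cases hz : z = 0 <;> simp [radialExt, hz]

theorem radialExt_const_smul (c : ℂ) (f : Sph n → ℂ) : radialExt (c • f) = c • radialExt f := by
  ext z
  by_cases hz : z = 0 <;> simp [radialExt, hz]

theorem radialExt_star (f : Sph n → ℂ) :
    radialExt (star f) = fun z => Complex.conjCLE (radialExt f z) := by
  ext z
  by_cases hz : z = 0 <;> simp [radialExt, hz]

theorem IsSmooth.add {f g : Sph n → ℂ} (hf : IsSmooth f) (hg : IsSmooth g) :
    IsSmooth (f + g) := by
  rw [IsSmooth, radialExt_add]
  exact ContDiffOn.add hf hg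

theorem IsSmooth.mul {f g : Sph n → ℂ} (hf : IsSmooth f) (hg : IsSmooth g) :
    IsSmooth (f * g) := by
  rw [IsSmooth, radialExt_mul]
  exact ContDiffOn.mul hf hg

theorem IsSmooth.const_smul {f : Sph n → ℂ} (c : ℂ) (hf : IsSmooth f) : IsSmooth (c • f) := by
  rw [IsSmooth, radialExt_const_smul]
  exact ContDiffOn.const_smul c hf

theorem IsSmooth.neg {f : Sph n → ℂ} (hf : IsSmooth f) : IsSmooth (-f) := by
  simpa using hf.const_smul (-1)

theorem IsSmooth.sub {f g : Sph n → ℂ} (hf : IsSmooth f) (hg : IsSmooth g) :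
    IsSmooth (f - g) := by
  simpa [sub_eq_add_neg] using hf.add hg.neg

theorem IsSmooth.star {f : Sph n → ℂ} (hf : IsSmooth f) : IsSmooth (star f) := by
  rw [IsSmooth, radialExt_star]
  exact Complex.conjCLE.contDiff.comp_contDiffOn hf

theorem isSmooth_zero : IsSmooth (0 : Sph n → ℂ) := by
  have : radialExt (0 : Sph n → ℂ) = fun _ => 0 := by
    ext z
    by_cases hz : z = 0 <;> simp [radialExt, hz]
  rw [IsSmooth, this]
  exact contDiffOn_const

theorem IsSmooth.sum {ι : Type*} (s : Finset ι) {f : ι → Sph n → ℂ}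
    (hf : ∀ i ∈ s, IsSmooth (f i)) : IsSmooth (∑ i ∈ s, f i) :=
  Finset.sum_induction f IsSmooth (fun _ _ => IsSmooth.add) isSmooth_zero hf

theorem isSmooth_coord (j : Fin (n + 1)) : IsSmooth (coord j : Sph n → ℂ) := by
  have h1 : ContDiffOn ℝ ∞ (fun z : Amb n => ‖z‖⁻¹ • z j) {0}ᶜ := by
    have h2 : ContDiffOn ℝ ∞ (fun z : Amb n => ‖z‖) {0}ᶜ := fun z hz =>
      (contDiffAt_norm ℝ (by simpa using hz)).contDiffWithinAt
    refine (h2.inv fun z hz => norm_ne_zero_iff.mpr (by simpa using hz)).smul ?_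
    exact ((EuclideanSpace.proj j : Amb n →L[ℂ] ℂ).restrictScalars ℝ).contDiff.contDiffOn
  refine h1.congr ?_
  intro z hz
  have hz' : z ≠ 0 := by simpa using hz
  simp [radialExt, hz', coord]

theorem IsSmooth.continuous {f : Sph n → ℂ} (hf : IsSmooth f) : Continuous f := by
  have : f = fun ξ : Sph n => radialExt f ξ := by
    ext ξ
    rw [radialExt_coe]
  rw [this]
  exact ContDiffOn.continuousOn hf |>.comp_continuous continuous_subtype_val
    fun ξ => ξ.coe_ne_zero

theorem IsSmooth.contDiffAt {f : Sph n → ℂ} (hf : IsSmooth f) {z : Amb n} (hz : z ≠ 0) :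
    ContDiffAt ℝ ∞ (radialExt f) z :=
  ContDiffOn.contDiffAt hf (isOpen_compl_singleton.mem_nhds hz)

theorem IsSmooth.differentiableAt {f : Sph n → ℂ} (hf : IsSmooth f) {z : Amb n} (hz : z ≠ 0) :
    DifferentiableAt ℝ (radialExt f) z :=
  (hf.contDiffAt hz).differentiableAt (by simp)

/-! ### Derivatives along linear vector fields -/

/-- The derivative of `f` along the linear vector field `ξ ↦ A ξ`. -/
def linDeriv (A : Amb n →L[ℝ] Amb n) (f : Sph n → ℂ) (ξ : Sph n) : ℂ :=
  dirDeriv f ξ (A ξ)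

/-- The differential of a function homogeneous of degree 0 has degree -1 and A z has degree 1, so
their pairing is again constant on rays. This lets derivatives be iterated by differentiating in the
ambient space. -/
theorem radialExt_linDeriv (A : Amb n →L[ℝ] Amb n) (f : Sph n → ℂ) {z : Amb n} (hz : z ≠ 0) :
    radialExt (linDeriv A f) z = fderiv ℝ (radialExt f) z (A z) := by
  obtain ⟨ξ, hξ⟩ := exists_eq_smul_sph hz
  have hz' : 0 < ‖z‖ := norm_pos_iff.mpr hz
  rw [radialExt_eq_of_smul _ hz' hξ, linDeriv, dirDeriv]
  have h1 : (fun w => radialExt f (‖z‖ • w)) = radialExt f := by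
    ext w
    exact radialExt_smul f hz'
  conv_lhs => rw [← h1]
  rw [fderiv_comp_smul, ← hξ, smul_apply, ← map_smul, ← map_smul, ← hξ]

theorem IsSmooth.linDeriv (A : Amb n →L[ℝ] Amb n) {f : Sph n → ℂ} (hf : IsSmooth f) :
    IsSmooth (linDeriv A f) := by
  refine ContDiffOn.congr ?_ (fun z hz => radialExt_linDeriv A f (by simpa using hz))
  refine ContDiffOn.clm_apply ?_ A.contDiff.contDiffOn
  exact ContDiffOn.fderiv_of_isOpen hf isOpen_compl_singleton (by simp)

theorem linDeriv_add (A : Amb n →L[ℝ] Amb n) {f g : Sph n → ℂ} (hf : IsSmooth f)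
    (hg : IsSmooth g) : linDeriv A (f + g) = linDeriv A f + linDeriv A g := by
  ext ξ
  simp only [linDeriv, dirDeriv, radialExt_add, Pi.add_apply]
  rw [fderiv_add (hf.differentiableAt ξ.coe_ne_zero) (hg.differentiableAt ξ.coe_ne_zero)]
  rfl

theorem linDeriv_const_smul (A : Amb n →L[ℝ] Amb n) (c : ℂ) {f : Sph n → ℂ} (hf : IsSmooth f) :
    linDeriv A (c • f) = c • linDeriv A f := by
  ext ξ
  simp only [linDeriv, dirDeriv, radialExt_const_smul, Pi.smul_apply]
  rw [fderiv_const_smul (hf.differentiableAt ξ.coe_ne_zero)]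
  rfl

theorem linDeriv_mul (A : Amb n →L[ℝ] Amb n) {f g : Sph n → ℂ} (hf : IsSmooth f)
    (hg : IsSmooth g) : linDeriv A (f * g) = f * linDeriv A g + linDeriv A f * g := by
  ext ξ
  simp only [linDeriv, dirDeriv, radialExt_mul, Pi.add_apply, Pi.mul_apply]
  rw [fderiv_mul (hf.differentiableAt ξ.coe_ne_zero) (hg.differentiableAt ξ.coe_ne_zero)]
  simp only [add_apply, smul_apply, radialExt_coe, smul_eq_mul]
  ring

theorem linDeriv_star (A : Amb n →L[ℝ] Amb n) {f : Sph n → ℂ} (hf : IsSmooth f) :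
    linDeriv A (star f) = star (linDeriv A f) := by
  ext ξ
  have := (Complex.conjCLE.toContinuousLinearMap.hasFDerivAt.comp (ξ : Amb n)
    (hf.differentiableAt ξ.coe_ne_zero).hasFDerivAt).fderiv
  simp only [linDeriv, dirDeriv, radialExt_star, Pi.star_apply]
  erw [this]
  simp

theorem linDeriv_field_smul (c : ℝ) (A : Amb n →L[ℝ] Amb n) (f : Sph n → ℂ) :
    linDeriv (c • A) f = (c : ℂ) • linDeriv A f := by
  ext ξ
  simp [linDeriv, dirDeriv]

theorem linDeriv_linDeriv (A B : Amb n →L[ℝ] Amb n) {f : Sph n → ℂ} (hf : IsSmooth f)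
    (ξ : Sph n) :
    linDeriv A (linDeriv B f) ξ =
      fderiv ℝ (fderiv ℝ (radialExt f)) ξ (A ξ) (B ξ) + fderiv ℝ (radialExt f) ξ (B (A ξ)) := by
  have h1 : radialExt (linDeriv B f) =ᶠ[𝓝 (ξ : Amb n)]
      fun z => fderiv ℝ (radialExt f) z (B z) := by
    filter_upwards [isOpen_compl_singleton.mem_nhds ξ.coe_ne_zero] with z hz
    exact radialExt_linDeriv B f hz
  have h2 : DifferentiableAt ℝ (fderiv ℝ (radialExt f)) (ξ : Amb n) :=
    ((hf.contDiffAt ξ.coe_ne_zero).fderiv_right (m := 1) (by norm_cast)).differentiableAt (by simp)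
  rw [linDeriv, dirDeriv, h1.fderiv_eq, fderiv_clm_apply h2 B.differentiableAt]
  simp [add_comm]

/-- The Hessian terms cancel by symmetry of second derivatives. The bracket of linear vector fields
is the matrix commutator in the opposite order. -/
theorem linDeriv_comm (A B : Amb n →L[ℝ] Amb n) {f : Sph n → ℂ} (hf : IsSmooth f) :
    linDeriv A (linDeriv B f) = linDeriv B (linDeriv A f) + linDeriv (B ∘L A - A ∘L B) f := by
  ext ξ
  have h := (hf.contDiffAt ξ.coe_ne_zero).isSymmSndFDerivAt
    (by
      rw [minSmoothness_of_isRCLikeNormedField]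
      exact WithTop.coe_le_coe.mpr (le_top : (2 : ℕ∞) ≤ ⊤))
  rw [Pi.add_apply, linDeriv_linDeriv A B hf, linDeriv_linDeriv B A hf, h.eq]
  simp [linDeriv, dirDeriv]

/-! ### Integration by parts -/

instance : IsFiniteMeasure (vol n) := by
  unfold vol
  exact Measure.smul_finite _ (ENNReal.natCast_ne_top _)

/-- The self-map of the sphere induced by a linear isometry. -/
def sphMap (e : Amb n ≃ₗᵢ[ℝ] Amb n) (ξ : Sph n) : Sph n :=
  ⟨e ξ, by simp⟩

theorem continuous_sphMap (e : Amb n ≃ₗᵢ[ℝ] Amb n) : Continuous (sphMap e) :=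
  (e.continuous.comp continuous_subtype_val).subtype_mk _

-- The sphere measure of a set is a multiple of the Lebesgue measure of the cone over it, and
-- isometries preserve both cones and Lebesgue measure.
open scoped Pointwise in
theorem measurePreserving_sphMap (e : Amb n ≃ₗᵢ[ℝ] Amb n) :
    MeasurePreserving (sphMap e) (vol n) (vol n) := by
  refine MeasurePreserving.smul_measure ⟨(continuous_sphMap e).measurable, ?_⟩ _
  ext s hs
  rw [Measure.map_apply (continuous_sphMap e).measurable hs, Measure.toSphere_apply' _ hs,
    Measure.toSphere_apply' _ ((continuous_sphMap e).measurable hs)]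
  congr 1
  have h : Set.Ioo (0 : ℝ) 1 • (Subtype.val '' (sphMap e ⁻¹' s)) =
      e ⁻¹' (Set.Ioo (0 : ℝ) 1 • (Subtype.val '' s)) := by
    ext z
    simp only [Set.mem_smul, Set.mem_image, Set.mem_preimage]
    constructor
    · rintro ⟨r, hr, _, ⟨ξ, hξ, rfl⟩, rfl⟩
      exact ⟨r, hr, _, ⟨_, hξ, rfl⟩, by simp [sphMap]⟩
    · rintro ⟨r, hr, _, ⟨ξ, hξ, rfl⟩, h⟩
      refine ⟨r, hr, e.symm ξ, ⟨⟨e.symm ξ, by simp⟩, ?_, rfl⟩, ?_⟩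
      · simpa [sphMap] using hξ
      · rw [← map_smul, h, e.symm_apply_apply]
  rw [h]
  exact e.measurePreserving.measure_preimage_emb e.toHomeomorph.measurableEmbedding _

/-- `A` is skew-symmetric for the real inner product, i.e. `ξ ↦ A ξ` is tangent to the sphere. -/
def IsSkew (A : Amb n →L[ℝ] Amb n) : Prop :=
  ∀ z, inner ℝ z (A z) = 0

theorem hasDerivAt_exp_apply (A : Amb n →L[ℝ] Amb n) (z : Amb n) (t : ℝ) :
    HasDerivAt (fun s : ℝ => NormedSpace.exp (s • A) z) (A (NormedSpace.exp (t • A) z)) t :=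
  (hasDerivAt_exp_smul_const' A t).clm_apply (hasDerivAt_const t z) |>.congr_deriv (by simp)

theorem IsSkew.norm_exp_apply {A : Amb n →L[ℝ] Amb n} (hA : IsSkew A) (t : ℝ) (z : Amb n) :
    ‖NormedSpace.exp (t • A) z‖ = ‖z‖ := by
  have h : ∀ s : ℝ, HasDerivAt (fun s : ℝ => ‖NormedSpace.exp (s • A) z‖ ^ 2) 0 s := fun s => by
    have := (hasDerivAt_exp_apply A z s).norm_sq
    rwa [hA, mul_zero] at this
  have h' := is_const_of_deriv_eq_zero (fun s => (h s).differentiableAt)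
    (fun s => (h s).deriv) t 0
  have h0 : NormedSpace.exp ((0 : ℝ) • A) z = z := by
    rw [zero_smul ℝ A, NormedSpace.exp_zero, one_apply_eq_self]
  rw [h0] at h'
  exact (sq_eq_sq₀ (norm_nonneg _) (norm_nonneg _)).mp h'

/-- The flow of the linear vector field `ξ ↦ A ξ`. -/
def IsSkew.flow {A : Amb n →L[ℝ] Amb n} (hA : IsSkew A) (t : ℝ) : Amb n ≃ₗᵢ[ℝ] Amb n :=
  LinearIsometry.toLinearIsometryEquiv
    ⟨(NormedSpace.exp (t • A) : Amb n →L[ℝ] Amb n).toLinearMap, hA.norm_exp_apply t⟩ rfl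

theorem IsSmooth.integrable {f : Sph n → ℂ} (hf : IsSmooth f) : Integrable f (vol n) :=
  hf.continuous.integrable_of_hasCompactSupport (HasCompactSupport.of_compactSpace f)

/-- The flow of a skew field consists of isometries, so the integral of f along the flow is constant
in time; differentiate it under the integral at time 0. -/
theorem integral_linDeriv {A : Amb n →L[ℝ] Amb n} (hA : IsSkew A) {f : Sph n → ℂ}
    (hf : IsSmooth f) : ∫ ξ, linDeriv A f ξ ∂(vol n) = 0 := by
  have hconst : ∀ t, ∫ ξ, f (sphMap (hA.flow t) ξ) ∂(vol n) = ∫ ξ, f ξ ∂(vol n) := fun t =>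
    (measurePreserving_sphMap (hA.flow t)).integral_comp'
      (f := (⟨⟨sphMap (hA.flow t), sphMap (hA.flow t).symm, fun ξ => by ext1; simp [sphMap],
        fun ξ => by ext1; simp [sphMap]⟩, (continuous_sphMap _).measurable,
        (continuous_sphMap _).measurable⟩ : Sph n ≃ᵐ Sph n)) f
  obtain ⟨C, hC⟩ : ∃ C, ∀ ξ, ‖linDeriv A f ξ‖ ≤ C := by
    obtain ⟨C, hC⟩ := isCompact_univ.exists_bound_of_continuousOn
      (hf.linDeriv A).continuous.continuousOn
    exact ⟨C, fun ξ => hC ξ trivial⟩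
  have hderiv : ∀ (ξ : Sph n) (t : ℝ), HasDerivAt (fun s => f (sphMap (hA.flow s) ξ))
      (linDeriv A f (sphMap (hA.flow t) ξ)) t := by
    intro ξ t
    have h1 := (hf.differentiableAt (sphMap (hA.flow t) ξ).coe_ne_zero).hasFDerivAt.comp_hasDerivAt
      t (hasDerivAt_exp_apply A ξ t)
    refine h1.congr_of_eventuallyEq (Eventually.of_forall fun s => ?_)
    exact (radialExt_coe f (sphMap (hA.flow s) ξ)).symm
  have h := (hasDerivAt_integral_of_dominated_loc_of_deriv_le (μ := vol n) (𝕜 := ℝ)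
    (F := fun t ξ => f (sphMap (hA.flow t) ξ))
    (F' := fun t ξ => linDeriv A f (sphMap (hA.flow t) ξ)) (bound := fun _ => C)
    (x₀ := 0) (s := Set.univ) univ_mem
    (Eventually.of_forall fun t =>
      (hf.continuous.comp (continuous_sphMap _)).aestronglyMeasurable)
    ((hf.continuous.comp (continuous_sphMap _)).integrable_of_hasCompactSupport
      (HasCompactSupport.of_compactSpace _))
    ((hf.linDeriv A).continuous.comp (continuous_sphMap _)).aestronglyMeasurable
    (Eventually.of_forall fun ξ t _ => hC _) (integrable_const C)
    (Eventually.of_forall fun ξ t _ => hderiv ξ t)).2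
  simp only [hconst] at h
  have h0 := h.unique (hasDerivAt_const (0 : ℝ) (∫ ξ, f ξ ∂(vol n)))
  rw [← h0]
  congr 1
  ext ξ
  congr 1
  ext1
  change (ξ : Amb n) = NormedSpace.exp ((0 : ℝ) • A) (ξ : Amb n)
  rw [zero_smul ℝ A, NormedSpace.exp_zero, one_apply_eq_self]

theorem integral_mul_linDeriv {A : Amb n →L[ℝ] Amb n} (hA : IsSkew A) {f g : Sph n → ℂ}
    (hf : IsSmooth f) (hg : IsSmooth g) :
    ∫ ξ, f ξ * linDeriv A g ξ ∂(vol n) = -∫ ξ, linDeriv A f ξ * g ξ ∂(vol n) := by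
  have h := integral_linDeriv hA (hf.mul hg)
  rw [linDeriv_mul A hf hg] at h
  have h2 := integral_add (hf.mul (hg.linDeriv A)).integrable ((hf.linDeriv A).mul hg).integrable
  rw [eq_neg_iff_add_eq_zero, ← h]
  exact h2.symm

/-! ### The horizontal fields and the Reeb field -/

/-- Multiplication by `i`. -/
def mulI : Amb n →L[ℝ] Amb n :=
  (Complex.I • ContinuousLinearMap.id ℂ (Amb n)).restrictScalars ℝ

theorem mulI_apply (z : Amb n) : mulI z = Complex.I • z := rfl

/-- The real-linear map `z ↦ z̄_j e_l - z̄_l e_j`. -/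
def horizMap (j l : Fin (n + 1)) : Amb n →L[ℝ] Amb n :=
  LinearMap.toContinuousLinearMap
    { toFun := fun z => EuclideanSpace.single l (star (z j)) - EuclideanSpace.single j (star (z l))
      map_add' := fun z w => by
        ext m
        simp
        split_ifs <;> ring
      map_smul' := fun c z => by
        ext m
        simp
        split_ifs <;> ring }

theorem horizMap_apply (j l : Fin (n + 1)) (z : Amb n) : horizMap j l z =
    EuclideanSpace.single l (star (z j)) - EuclideanSpace.single j (star (z l)) := rfl

/-- Antilinearity of the coefficient vectors is what drives all the brackets computed below. -/
theorem horizMap_mulI (j l : Fin (n + 1)) (z : Amb n) :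
    horizMap j l (mulI z) = -mulI (horizMap j l z) := by
  ext m
  simp [horizMap_apply, mulI_apply]
  split_ifs <;> ring

theorem mulI_mulI (z : Amb n) : mulI (mulI z) = -z := by
  rw [mulI_apply, mulI_apply, smul_smul, Complex.I_mul_I, neg_one_smul]

theorem isSkew_mulI : IsSkew (mulI : Amb n →L[ℝ] Amb n) := by
  intro z
  simp only [PiLp.inner_apply, mulI_apply, PiLp.smul_apply, Complex.inner]
  refine Finset.sum_eq_zero fun m _ => ?_
  simp
  ring

theorem isSkew_horizMap (j l : Fin (n + 1)) : IsSkew (horizMap j l) := by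
  intro z
  simp only [PiLp.inner_apply, horizMap_apply, PiLp.single_apply,
    inner_sub_right]
  simp only [apply_ite (inner ℝ _), inner_zero_right, Finset.sum_ite_eq', Finset.mem_univ, if_true,
    Complex.inner]
  simp
  ring

theorem isSkew_mulI_horizMap (j l : Fin (n + 1)) : IsSkew (mulI ∘L horizMap j l) := by
  intro z
  simp only [PiLp.inner_apply, horizMap_apply, mulI_apply, ContinuousLinearMap.comp_apply,
    PiLp.smul_apply, PiLp.single_apply, smul_sub, smul_ite, smul_zero,
    inner_sub_right]
  simp only [apply_ite (inner ℝ _), inner_zero_right, Finset.sum_ite_eq', Finset.mem_univ, if_true,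
    Complex.inner]
  simp
  ring

/-- The unit `-i` or `i` distinguishing `Z_{jl}` from `Z̄_{jl}`. -/
def labelUnit (b : Bool) : ℂ := if b then Complex.I else -Complex.I

theorem labelUnit_mul_self (b : Bool) : labelUnit b * labelUnit b = -1 := by
  cases b <;> simp [labelUnit]

theorem star_labelUnit (b : Bool) : star (labelUnit b) = labelUnit (!b) := by
  cases b <;> simp [labelUnit]

theorem horiz_eq (j l : Fin (n + 1)) (b : Bool) (f : Sph n → ℂ) :
    horiz (j, l, b) f = (1 / 2 : ℂ) •
      (linDeriv (horizMap j l) f + labelUnit b • linDeriv (mulI ∘L horizMap j l) f) := by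
  cases b
  · ext ξ
    change Z j l f ξ = _
    simp only [Z, Pi.smul_apply, Pi.add_apply, smul_eq_mul, linDeriv, labelUnit]
    change (dirDeriv f ξ (horizMap j l ξ) -
      Complex.I * dirDeriv f ξ (mulI (horizMap j l ξ))) / 2 = _
    simp
    ring
  · ext ξ
    change Zbar j l f ξ = _
    simp only [Zbar, Pi.smul_apply, Pi.add_apply, smul_eq_mul, linDeriv, labelUnit]
    change (dirDeriv f ξ (horizMap j l ξ) +
      Complex.I * dirDeriv f ξ (mulI (horizMap j l ξ))) / 2 = _
    simp
    ring

theorem reeb_eq (f : Sph n → ℂ) : reeb f = linDeriv mulI f := rfl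

theorem IsSmooth.horiz {f : Sph n → ℂ} (hf : IsSmooth f) (a : Label n) :
    IsSmooth (horiz a f) := by
  obtain ⟨j, l, b⟩ := a
  rw [horiz_eq]
  exact ((hf.linDeriv _).add ((hf.linDeriv _).const_smul _)).const_smul _

theorem IsSmooth.reeb {f : Sph n → ℂ} (hf : IsSmooth f) : IsSmooth (reeb f) :=
  hf.linDeriv mulI

theorem horiz_add (a : Label n) {f g : Sph n → ℂ} (hf : IsSmooth f) (hg : IsSmooth g) :
    horiz a (f + g) = horiz a f + horiz a g := by
  obtain ⟨j, l, b⟩ := a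
  simp only [horiz_eq, linDeriv_add _ hf hg]
  module

theorem horiz_const_smul (a : Label n) (c : ℂ) {f : Sph n → ℂ} (hf : IsSmooth f) :
    horiz a (c • f) = c • horiz a f := by
  obtain ⟨j, l, b⟩ := a
  simp only [horiz_eq, linDeriv_const_smul _ c hf]
  module

theorem horiz_mul (a : Label n) {f g : Sph n → ℂ} (hf : IsSmooth f) (hg : IsSmooth g) :
    horiz a (f * g) = f * horiz a g + horiz a f * g := by
  obtain ⟨j, l, b⟩ := a
  simp only [horiz_eq, linDeriv_mul _ hf hg]
  ext ξ
  simp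
  ring

/-- The label of the conjugate field. -/
def Label.conj (a : Label n) : Label n := (a.1, a.2.1, !a.2.2)

theorem Label.conj_conj (a : Label n) : a.conj.conj = a := by
  simp [Label.conj]

theorem horiz_star (a : Label n) {f : Sph n → ℂ} (hf : IsSmooth f) :
    horiz a (star f) = star (horiz a.conj f) := by
  obtain ⟨j, l, b⟩ := a
  simp only [Label.conj, horiz_eq, linDeriv_star _ hf, star_smul, star_add, star_labelUnit]
  simp

theorem IsSmooth.integrable_mul {f g : Sph n → ℂ} (hf : IsSmooth f) (hg : IsSmooth g) :
    Integrable (fun ξ => f ξ * g ξ) (vol n) :=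
  (hf.mul hg).integrable

theorem integral_mul_horiz (a : Label n) {f g : Sph n → ℂ} (hf : IsSmooth f) (hg : IsSmooth g) :
    ∫ ξ, f ξ * horiz a g ξ ∂(vol n) = -∫ ξ, horiz a f ξ * g ξ ∂(vol n) := by
  obtain ⟨j, l, b⟩ := a
  have h1 := integral_mul_linDeriv (isSkew_horizMap j l) hf hg
  have h2 := integral_mul_linDeriv (isSkew_mulI_horizMap j l) hf hg
  have e1 : ∀ ξ, f ξ * horiz (j, l, b) g ξ = 1 / 2 * (f ξ * linDeriv (horizMap j l) g ξ) +
      1 / 2 * labelUnit b * (f ξ * linDeriv (mulI ∘L horizMap j l) g ξ) := fun ξ => by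
    simp only [horiz_eq, Pi.smul_apply, Pi.add_apply, smul_eq_mul]
    ring
  have e2 : ∀ ξ, horiz (j, l, b) f ξ * g ξ = 1 / 2 * (linDeriv (horizMap j l) f ξ * g ξ) +
      1 / 2 * labelUnit b * (linDeriv (mulI ∘L horizMap j l) f ξ * g ξ) := fun ξ => by
    simp only [horiz_eq, Pi.smul_apply, Pi.add_apply, smul_eq_mul]
    ring
  simp only [e1, e2]
  rw [integral_add ((hf.integrable_mul (hg.linDeriv _)).const_mul _)
    ((hf.integrable_mul (hg.linDeriv _)).const_mul _),
    integral_add (((hf.linDeriv _).integrable_mul hg).const_mul _)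
    (((hf.linDeriv _).integrable_mul hg).const_mul _)]
  simp only [integral_const_mul, h1, h2]
  ring

/-- The horizontal fields are weight vectors for the Reeb field, with opposite weights for Z_{jl}
and its conjugate. The two real parts of the field are exchanged, up to the factors ±2, by the
bracket with T. -/
theorem reeb_horiz (a : Label n) {f : Sph n → ℂ} (hf : IsSmooth f) :
    reeb (horiz a f) = horiz a (reeb f) + (2 * labelUnit a.2.2) • horiz a f := by
  obtain ⟨j, l, b⟩ := a
  have c1 : horizMap j l ∘L mulI - mulI ∘L horizMap j l =
      (-2 : ℝ) • (mulI ∘L horizMap j l) := by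
    ext1 z
    simp only [FunLike.coe_sub, Pi.sub_apply, ContinuousLinearMap.comp_apply,
      horizMap_mulI, FunLike.coe_smul, Pi.smul_apply]
    module
  have c2 : (mulI ∘L horizMap j l) ∘L mulI - mulI ∘L (mulI ∘L horizMap j l) =
      (2 : ℝ) • horizMap j l := by
    ext1 z
    simp only [FunLike.coe_sub, Pi.sub_apply, ContinuousLinearMap.comp_apply,
      horizMap_mulI, FunLike.coe_smul, Pi.smul_apply, map_neg, mulI_mulI]
    module
  have h1 := linDeriv_comm mulI (horizMap j l) hf
  have h2 := linDeriv_comm mulI (mulI ∘L horizMap j l) hf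
  rw [c1, linDeriv_field_smul] at h1
  rw [c2, linDeriv_field_smul] at h2
  have hb := labelUnit_mul_self b
  simp only [horiz_eq, reeb_eq]
  rw [linDeriv_const_smul _ _ ((hf.linDeriv _).add ((hf.linDeriv _).const_smul _)),
    linDeriv_add _ (hf.linDeriv _) ((hf.linDeriv _).const_smul _),
    linDeriv_const_smul _ _ (hf.linDeriv _), h1, h2]
  ext ξ
  simp only [Pi.smul_apply, Pi.add_apply, smul_eq_mul, Complex.ofReal_neg, Complex.ofReal_ofNat]
  linear_combination (-linDeriv (mulI ∘L horizMap j l) f ξ) * hb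

/-- For j ≠ l the square of the map is minus the projection to the coordinates j and l, and it
vanishes for j = l. Each coordinate belongs to 2n ordered pairs of distinct indices. -/
theorem sum_horizMap_horizMap (z : Amb n) :
    ∑ j, ∑ l, horizMap j l (horizMap j l z) = (-2 * n : ℝ) • z := by
  ext m
  simp [horizMap_apply, Pi.single_apply, Finset.sum_sub_distrib, apply_ite (starRingEnd ℂ),
    Finset.sum_ite_irrel]
  ring

theorem horiz_commutator (j l : Fin (n + 1)) {f : Sph n → ℂ} (hf : IsSmooth f) :
    horiz (j, l, false) (horiz (j, l, true) f) - horiz (j, l, true) (horiz (j, l, false) f) =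
      Complex.I • linDeriv (mulI ∘L horizMap j l ∘L horizMap j l) f := by
  have c : (mulI ∘L horizMap j l) ∘L horizMap j l - horizMap j l ∘L (mulI ∘L horizMap j l) =
      (2 : ℝ) • (mulI ∘L horizMap j l ∘L horizMap j l) := by
    ext1 z
    simp only [FunLike.coe_sub, Pi.sub_apply, ContinuousLinearMap.comp_apply,
      horizMap_mulI, FunLike.coe_smul, Pi.smul_apply]
    module
  have h := linDeriv_comm (horizMap j l) (mulI ∘L horizMap j l) hf
  rw [c, linDeriv_field_smul] at h
  have hs : ∀ b, IsSmooth (labelUnit b • linDeriv (mulI ∘L horizMap j l) f) :=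
    fun b => (hf.linDeriv _).const_smul _
  simp only [horiz_eq, linDeriv_const_smul _ _ ((hf.linDeriv _).add (hs _)),
    linDeriv_add _ (hf.linDeriv _) (hs _), linDeriv_const_smul _ _ (hf.linDeriv _), h]
  ext ξ
  simp only [Pi.smul_apply, Pi.add_apply, Pi.sub_apply, smul_eq_mul, Complex.ofReal_ofNat,
    labelUnit, if_true, Bool.false_eq_true, if_false]
  ring

/-- Bracket generation in explicit form: for n ≥ 1 this recovers T from second-order horizontal
operators. -/
theorem sum_horiz_commutator {f : Sph n → ℂ} (hf : IsSmooth f) :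
    ∑ j, ∑ l, (horiz (j, l, false) (horiz (j, l, true) f) -
      horiz (j, l, true) (horiz (j, l, false) f)) = (-2 * n * Complex.I) • reeb f := by
  ext ξ
  simp only [horiz_commutator _ _ hf, Finset.sum_apply, Pi.smul_apply, ← Finset.smul_sum, linDeriv,
    dirDeriv, ContinuousLinearMap.comp_apply, ← map_sum, reeb, sum_horizMap_horizMap]
  rw [map_smul mulI, map_smul, mulI_apply]
  simp
  ring

/-! ### The operators `L_μ` and `P_k` on smooth functions -/

theorem linDeriv_sum (A : Amb n →L[ℝ] Amb n) {ι : Type*} (s : Finset ι) {f : ι → Sph n → ℂ}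
    (hf : ∀ i, IsSmooth (f i)) : linDeriv A (∑ i ∈ s, f i) = ∑ i ∈ s, linDeriv A (f i) := by
  classical
  induction s using Finset.induction_on with
  | empty => simpa using linDeriv_const_smul A 0 isSmooth_zero
  | insert i s hi ih =>
    rw [Finset.sum_insert hi, Finset.sum_insert hi,
      linDeriv_add A (hf i) (IsSmooth.sum s fun i _ => hf i), ih]

theorem subLaplacian_eq (f : Sph n → ℂ) : subLaplacian f = (-(1 / 2) : ℂ) •
    ∑ j, ∑ l, (horiz (j, l, false) (horiz (j, l, true) f) +
      horiz (j, l, true) (horiz (j, l, false) f)) := by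
  ext ξ
  simp [subLaplacian, horiz]

theorem Lop_eq (μ : ℝ) (f : Sph n → ℂ) : Lop μ f = (1 / 2 : ℂ) • subLaplacian f +
    ((Complex.I / 2 * μ) • reeb f + (1 / 4 * ((n : ℂ) - μ) * ((n : ℂ) + μ)) • f) := by
  ext ξ
  simp [Lop]
  ring

theorem isSmooth_sublaplacian_summand {f : Sph n → ℂ} (hf : IsSmooth f) (j l : Fin (n + 1)) :
    IsSmooth (horiz (j, l, false) (horiz (j, l, true) f) +
      horiz (j, l, true) (horiz (j, l, false) f)) :=
  ((hf.horiz _).horiz _).add ((hf.horiz _).horiz _)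

theorem IsSmooth.subLaplacian {f : Sph n → ℂ} (hf : IsSmooth f) : IsSmooth (subLaplacian f) := by
  rw [subLaplacian_eq]
  exact (IsSmooth.sum _ fun j _ => IsSmooth.sum _ fun l _ =>
    isSmooth_sublaplacian_summand hf j l).const_smul _

theorem IsSmooth.Lop (μ : ℝ) {f : Sph n → ℂ} (hf : IsSmooth f) : IsSmooth (Lop μ f) := by
  rw [Lop_eq]
  exact (hf.subLaplacian.const_smul _).add ((hf.reeb.const_smul _).add (hf.const_smul _))

theorem subLaplacian_add {f g : Sph n → ℂ} (hf : IsSmooth f) (hg : IsSmooth g) :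
    subLaplacian (f + g) = subLaplacian f + subLaplacian g := by
  simp only [subLaplacian_eq, horiz_add _ hf hg, horiz_add _ (hf.horiz _) (hg.horiz _),
    ← smul_add, ← Finset.sum_add_distrib]
  congr 1
  refine Finset.sum_congr rfl fun j _ => Finset.sum_congr rfl fun l _ => ?_
  abel

theorem subLaplacian_const_smul (c : ℂ) {f : Sph n → ℂ} (hf : IsSmooth f) :
    subLaplacian (c • f) = c • subLaplacian f := by
  simp only [subLaplacian_eq, horiz_const_smul _ _ hf, horiz_const_smul _ _ (hf.horiz _),
    ← smul_add, ← Finset.smul_sum]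
  rw [smul_comm]

theorem subLaplacian_star {f : Sph n → ℂ} (hf : IsSmooth f) :
    subLaplacian (star f) = star (subLaplacian f) := by
  simp only [subLaplacian_eq, horiz_star _ hf, horiz_star _ (hf.horiz _), Label.conj, star_smul,
    star_sum, star_add]
  simp only [Bool.not_false, Bool.not_true, add_comm]
  simp

theorem reeb_add {f g : Sph n → ℂ} (hf : IsSmooth f) (hg : IsSmooth g) :
    reeb (f + g) = reeb f + reeb g :=
  linDeriv_add mulI hf hg

theorem reeb_const_smul (c : ℂ) {f : Sph n → ℂ} (hf : IsSmooth f) :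
    reeb (c • f) = c • reeb f :=
  linDeriv_const_smul mulI c hf

/-- The opposite weights of a field and its conjugate cancel in the product. This is why T commutes
with the sub-Laplacian. -/
theorem reeb_horiz_horiz (j l : Fin (n + 1)) (b : Bool) {f : Sph n → ℂ} (hf : IsSmooth f) :
    reeb (horiz (j, l, b) (horiz (j, l, !b) f)) = horiz (j, l, b) (horiz (j, l, !b) (reeb f)) := by
  rw [reeb_horiz _ (hf.horiz _), reeb_horiz _ hf,
    horiz_add _ (hf.reeb.horiz _) ((hf.horiz _).const_smul _), horiz_const_smul _ _ (hf.horiz _)]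
  cases b <;> simp [labelUnit]

theorem reeb_subLaplacian {f : Sph n → ℂ} (hf : IsSmooth f) :
    reeb (subLaplacian f) = subLaplacian (reeb f) := by
  have hs := isSmooth_sublaplacian_summand hf
  rw [subLaplacian_eq, subLaplacian_eq, reeb_const_smul _
    (IsSmooth.sum _ fun j _ => IsSmooth.sum _ fun l _ => hs j l), reeb_eq,
    linDeriv_sum _ _ fun j => IsSmooth.sum _ fun l _ => hs j l]
  congr 1
  refine Finset.sum_congr rfl fun j _ => ?_
  rw [linDeriv_sum _ _ fun l => hs j l]
  refine Finset.sum_congr rfl fun l _ => ?_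
  rw [← reeb_eq, reeb_add ((hf.horiz _).horiz _) ((hf.horiz _).horiz _)]
  exact congrArg₂ _ (reeb_horiz_horiz j l false hf) (reeb_horiz_horiz j l true hf)

/-- Both operators are affine combinations of the commuting operators Δ_b and T. -/
theorem Lop_comm (μ ν : ℝ) {f : Sph n → ℂ} (hf : IsSmooth f) :
    Lop μ (Lop ν f) = Lop ν (Lop μ f) := by
  have hS : ∀ μ : ℝ, subLaplacian (Lop μ f) = (1 / 2 : ℂ) • subLaplacian (subLaplacian f) +
      ((Complex.I / 2 * μ) • subLaplacian (reeb f) +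
        (1 / 4 * ((n : ℂ) - μ) * ((n : ℂ) + μ)) • subLaplacian f) := fun μ => by
    rw [Lop_eq, subLaplacian_add (hf.subLaplacian.const_smul _)
      ((hf.reeb.const_smul _).add (hf.const_smul _)), subLaplacian_add (hf.reeb.const_smul _)
      (hf.const_smul _), subLaplacian_const_smul _ hf.subLaplacian,
      subLaplacian_const_smul _ hf.reeb, subLaplacian_const_smul _ hf]
  have hT : ∀ μ : ℝ, reeb (Lop μ f) = (1 / 2 : ℂ) • subLaplacian (reeb f) +
      ((Complex.I / 2 * μ) • reeb (reeb f) +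
        (1 / 4 * ((n : ℂ) - μ) * ((n : ℂ) + μ)) • reeb f) := fun μ => by
    rw [Lop_eq, reeb_add (hf.subLaplacian.const_smul _)
      ((hf.reeb.const_smul _).add (hf.const_smul _)), reeb_add (hf.reeb.const_smul _)
      (hf.const_smul _), reeb_const_smul _ hf.subLaplacian, reeb_const_smul _ hf.reeb,
      reeb_const_smul _ hf, reeb_subLaplacian hf]
  rw [Lop_eq μ (Lop ν f), Lop_eq ν (Lop μ f), hS, hS, hT, hT, Lop_eq μ f, Lop_eq ν f]
  module

/-- Δ_b and T are real, so conjugation only changes the sign of the factor i in front of μT. -/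
theorem Lop_star (μ : ℝ) {f : Sph n → ℂ} (hf : IsSmooth f) :
    Lop μ (star f) = star (Lop (-μ) f) := by
  rw [Lop_eq, Lop_eq, subLaplacian_star hf, reeb_eq, linDeriv_star _ hf, reeb_eq]
  ext ξ
  simp
  ring

/-- `O` and `O'` preserve smoothness and `∫ f (O g) = c ∫ (O' f) g` for smooth `f` and `g`. -/
structure IsTransp (c : ℂ) (O O' : (Sph n → ℂ) → Sph n → ℂ) : Prop where
  smooth_left : ∀ f, IsSmooth f → IsSmooth (O f)
  smooth_right : ∀ f, IsSmooth f → IsSmooth (O' f)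
  integral_eq : ∀ f g, IsSmooth f → IsSmooth g →
    ∫ ξ, f ξ * O g ξ ∂(vol n) = c * ∫ ξ, O' f ξ * g ξ ∂(vol n)

theorem isTransp_horiz (a : Label n) : IsTransp (-1) (horiz a) (horiz a) :=
  ⟨fun _ hf => hf.horiz a, fun _ hf => hf.horiz a, fun f g hf hg => by
    rw [integral_mul_horiz a hf hg, neg_one_mul]⟩

theorem isTransp_reeb : IsTransp (-1) (reeb (n := n)) reeb :=
  ⟨fun _ hf => hf.reeb, fun _ hf => hf.reeb, fun f g hf hg => by
    rw [reeb_eq, reeb_eq, integral_mul_linDeriv isSkew_mulI hf hg, neg_one_mul]⟩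

theorem isTransp_id : IsTransp (n := n) 1 (fun f => f) (fun f => f) :=
  ⟨fun _ hf => hf, fun _ hf => hf, fun f g _ _ => by rw [one_mul]⟩

theorem IsTransp.comp {c d : ℂ} {O O' U U' : (Sph n → ℂ) → Sph n → ℂ} (h : IsTransp c O O')
    (h' : IsTransp d U U') : IsTransp (c * d) (fun f => O (U f)) (fun f => U' (O' f)) :=
  ⟨fun _ hf => h.smooth_left _ (h'.smooth_left _ hf),
    fun _ hf => h'.smooth_right _ (h.smooth_right _ hf), fun f g hf hg => by
    rw [h.integral_eq f (U g) hf (h'.smooth_left g hg),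
      h'.integral_eq (O' f) g (h.smooth_right f hf) hg, mul_assoc]⟩

theorem IsTransp.add {c : ℂ} {O O' U U' : (Sph n → ℂ) → Sph n → ℂ} (h : IsTransp c O O')
    (h' : IsTransp c U U') : IsTransp c (fun f => O f + U f) (fun f => O' f + U' f) :=
  ⟨fun _ hf => (h.smooth_left _ hf).add (h'.smooth_left _ hf),
    fun _ hf => (h.smooth_right _ hf).add (h'.smooth_right _ hf), fun f g hf hg => by
    simp only [Pi.add_apply, mul_add, add_mul]
    rw [integral_add (hf.integrable_mul (h.smooth_left g hg))
      (hf.integrable_mul (h'.smooth_left g hg)),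
      integral_add ((h.smooth_right f hf).integrable_mul hg)
      ((h'.smooth_right f hf).integrable_mul hg),
      h.integral_eq f g hf hg, h'.integral_eq f g hf hg, mul_add]⟩

theorem IsTransp.smul {c : ℂ} {O O' : (Sph n → ℂ) → Sph n → ℂ} (h : IsTransp c O O') (a b d : ℂ)
    (hd : a * c = d * b) : IsTransp d (fun f => a • O f) (fun f => b • O' f) :=
  ⟨fun _ hf => (h.smooth_left _ hf).const_smul a, fun _ hf => (h.smooth_right _ hf).const_smul b,
    fun f g hf hg => by
    simp only [Pi.smul_apply, smul_eq_mul, mul_left_comm _ a, mul_assoc b]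
    rw [integral_const_mul, integral_const_mul, h.integral_eq f g hf hg, ← mul_assoc, hd,
      mul_assoc]⟩

theorem IsTransp.sum {ι : Type*} (s : Finset ι) {c : ℂ} {O O' : ι → (Sph n → ℂ) → Sph n → ℂ}
    (h : ∀ i, IsTransp c (O i) (O' i)) :
    IsTransp c (fun f => ∑ i ∈ s, O i f) (fun f => ∑ i ∈ s, O' i f) := by
  classical
  induction s using Finset.induction_on with
  | empty =>
    exact ⟨fun f _ => by simpa using isSmooth_zero, fun f _ => by simpa using isSmooth_zero,
      fun f g _ _ => by simp⟩
  | insert i s hi ih =>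
    simp only [Finset.sum_insert hi]
    exact (h i).add ih

theorem isTransp_subLaplacian : IsTransp (n := n) 1 subLaplacian subLaplacian := by
  have h : ∀ j l : Fin (n + 1), IsTransp 1
      (fun f => horiz (j, l, false) (horiz (j, l, true) f) +
        horiz (j, l, true) (horiz (j, l, false) f))
      (fun f => horiz (j, l, false) (horiz (j, l, true) f) +
        horiz (j, l, true) (horiz (j, l, false) f)) := fun j l => by
    have h1 := ((isTransp_horiz (j, l, false)).comp (isTransp_horiz (j, l, true))).add
      ((isTransp_horiz (j, l, true)).comp (isTransp_horiz (j, l, false)))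
    simp only [add_comm (horiz (j, l, true) (horiz (j, l, false) _))] at h1 ⊢
    simpa using h1
  have h2 := (IsTransp.sum Finset.univ fun j =>
    IsTransp.sum Finset.univ fun l => h j l).smul (-(1 / 2)) (-(1 / 2)) 1 (by ring)
  simpa only [← subLaplacian_eq] using h2

/-- Δ_b is symmetric, T is antisymmetric, and the zeroth-order term is even in μ. -/
theorem isTransp_Lop (μ : ℝ) : IsTransp (n := n) 1 (Lop μ) (Lop (-μ)) := by
  have h := (isTransp_subLaplacian (n := n)).smul (1 / 2) (1 / 2) 1 (by ring) |>.add
    ((isTransp_reeb.smul (Complex.I / 2 * μ) (Complex.I / 2 * (-μ : ℝ)) 1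
      (by push_cast; ring)).add (isTransp_id.smul (1 / 4 * ((n : ℂ) - μ) * ((n : ℂ) + μ))
        (1 / 4 * ((n : ℂ) - (-μ : ℝ)) * ((n : ℂ) + (-μ : ℝ))) 1 (by push_cast; ring)))
  simpa only [← Lop_eq] using h

/-- The composition of the operators `L_μ` for `μ` in a list. -/
def LopList (l : List ℝ) (f : Sph n → ℂ) : Sph n → ℂ := l.foldr Lop f

theorem isTransp_LopList (l : List ℝ) :
    IsTransp (n := n) 1 (LopList l) (LopList (l.reverse.map (-·))) := by
  induction l with
  | nil => exact isTransp_id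
  | cons μ l ih =>
    have h := (isTransp_Lop μ).comp ih
    rw [one_mul] at h
    have e : LopList ((μ :: l).reverse.map (-·)) =
        fun f : Sph n → ℂ => LopList (l.reverse.map (-·)) (Lop (-μ) f) := by
      ext1 f
      rw [List.reverse_cons, List.map_append, LopList, List.foldr_append]
      rfl
    rw [e]
    exact h

theorem IsSmooth.LopList (l : List ℝ) {f : Sph n → ℂ} (hf : IsSmooth f) :
    IsSmooth (LopList l f) :=
  (isTransp_LopList l).smooth_left f hf

theorem LopList_perm {l l' : List ℝ} (h : l.Perm l') {f : Sph n → ℂ} (hf : IsSmooth f) :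
    LopList l f = LopList l' f := by
  induction h with
  | nil => rfl
  | cons μ _ ih => exact congrArg (Lop μ) ih
  | swap μ ν l => exact Lop_comm ν μ (hf.LopList l)
  | trans _ _ ih ih' => exact ih.trans ih'

theorem LopList_star (l : List ℝ) {f : Sph n → ℂ} (hf : IsSmooth f) :
    LopList l (star f) = star (LopList (l.map (-·)) f) := by
  induction l with
  | nil => rfl
  | cons μ l ih =>
    change Lop μ (LopList l (star f)) = _
    rw [ih, Lop_star μ (hf.LopList _)]
    rfl

/-- The parameters `k - 1, k - 3, …, 1 - k` of the factors of `P_k`. -/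
def gjmsParams (k : ℕ) : List ℝ := (List.range k).map fun j : ℕ => (k : ℝ) - 2 * j - 1

theorem gjms_eq (k : ℕ) (f : Sph n → ℂ) : gjms k f = LopList (gjmsParams k) f := by
  -- In the definition of `gjms` the fold index is real, so the range is coerced to a list of reals
  -- through the list monad; this turns the coercion into a plain map.
  have h : (do let a ← List.range k; pure (a : ℝ)) = (List.range k).map (Nat.cast : ℕ → ℝ) :=
    List.flatMap_pure_eq_map _ _
  rw [gjms, LopList, gjmsParams, List.foldr_map, h, List.foldr_map]

/-- The parameters are symmetric about 0: replacing j by k - 1 - j changes the sign. -/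
theorem gjmsParams_reverse (k : ℕ) : (gjmsParams k).reverse.map (-·) = gjmsParams k := by
  refine List.ext_getElem (by simp [gjmsParams]) fun i h1 h2 => ?_
  have hi : i < k := by simpa [gjmsParams] using h2
  simp only [gjmsParams, List.getElem_map, List.getElem_reverse, List.length_map,
    List.length_range, List.getElem_range]
  rw [Nat.cast_sub (by omega), Nat.cast_sub (by omega)]
  push_cast
  ring

theorem IsSmooth.gjms (k : ℕ) {f : Sph n → ℂ} (hf : IsSmooth f) : IsSmooth (gjms k f) := by
  rw [gjms_eq]
  exact hf.LopList _

/-- Transposition both reverses the factors and negates their parameters, which restores the same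
list. -/
theorem integral_mul_gjms (k : ℕ) {f g : Sph n → ℂ} (hf : IsSmooth f) (hg : IsSmooth g) :
    ∫ ξ, f ξ * gjms k g ξ ∂(vol n) = ∫ ξ, g ξ * gjms k f ξ ∂(vol n) := by
  have h := (isTransp_LopList (gjmsParams k)).integral_eq f g hf hg
  rw [gjmsParams_reverse, one_mul] at h
  simp only [gjms_eq, h, mul_comm]

/-- Conjugation negates the parameters without reversing the order, so here the commutation of the
factors is needed. -/
theorem gjms_star (k : ℕ) {f : Sph n → ℂ} (hf : IsSmooth f) :
    gjms k (star f) = star (gjms k f) := by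
  have h : ((gjmsParams k).map (-·)).Perm (gjmsParams k) := by
    conv_rhs => rw [← gjmsParams_reverse]
    exact (List.reverse_perm _).symm.map _
  rw [gjms_eq, gjms_eq, LopList_star _ hf, LopList_perm h hf]

/-! ### Operators of bounded horizontal order -/

theorem IsSmooth.horizWord (w : List (Label n)) {f : Sph n → ℂ} (hf : IsSmooth f) :
    IsSmooth (horizWord w f) := by
  induction w with
  | nil => exact hf
  | cons a w ih => exact ih.horiz a

theorem horizWord_cons (a : Label n) (w : List (Label n)) (f : Sph n → ℂ) :
    horizWord (a :: w) f = horiz a (horizWord w f) := rfl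

theorem horizWord_append (w w' : List (Label n)) (f : Sph n → ℂ) :
    horizWord (w ++ w') f = horizWord w (horizWord w' f) :=
  List.foldr_append

theorem horizWord_add (w : List (Label n)) {f g : Sph n → ℂ} (hf : IsSmooth f)
    (hg : IsSmooth g) : horizWord w (f + g) = horizWord w f + horizWord w g := by
  induction w with
  | nil => rfl
  | cons a w ih =>
    simp only [horizWord_cons, ih, horiz_add a (hf.horizWord w) (hg.horizWord w)]

theorem horizWord_const_smul (w : List (Label n)) (c : ℂ) {f : Sph n → ℂ} (hf : IsSmooth f) :
    horizWord w (c • f) = c • horizWord w f := by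
  induction w with
  | nil => rfl
  | cons a w ih => simp only [horizWord_cons, ih, horiz_const_smul a c (hf.horizWord w)]

theorem horizWord_star (w : List (Label n)) {f : Sph n → ℂ} (hf : IsSmooth f) :
    horizWord w (star f) = star (horizWord (w.map Label.conj) f) := by
  induction w with
  | nil => rfl
  | cons a w ih =>
    rw [horizWord_cons, ih, horiz_star a (hf.horizWord _)]
    rfl

theorem isTransp_horizWord (w : List (Label n)) :
    IsTransp ((-1) ^ w.length) (horizWord w) (horizWord w.reverse) := by
  induction w with
  | nil => exact isTransp_id
  | cons a w ih =>
    have h := (isTransp_horiz a).comp ih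
    rw [List.length_cons, pow_succ', List.reverse_cons]
    have e : horizWord (w.reverse ++ [a]) = fun f => horizWord w.reverse (horiz a f) := by
      ext1 f
      rw [horizWord_append]
      rfl
    rw [e]
    exact h

/-- Linear combinations, on smooth functions, of words of length at most `m` in the horizontal
fields. -/
inductive HorizOp (m : ℕ) : ((Sph n → ℂ) → Sph n → ℂ) → Prop
  | word (w : List (Label n)) (h : w.length ≤ m) : HorizOp m (horizWord w)
  | add {O U : (Sph n → ℂ) → Sph n → ℂ} (hO : HorizOp m O) (hU : HorizOp m U) :
      HorizOp m (fun f => O f + U f)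
  | smul (c : ℂ) {O : (Sph n → ℂ) → Sph n → ℂ} (hO : HorizOp m O) : HorizOp m (fun f => c • O f)
  | congr {O U : (Sph n → ℂ) → Sph n → ℂ} (hO : HorizOp m O)
      (h : ∀ f, IsSmooth f → U f = O f) : HorizOp m U

theorem HorizOp.isSmooth {m : ℕ} {O : (Sph n → ℂ) → Sph n → ℂ} (hO : HorizOp m O)
    {f : Sph n → ℂ} (hf : IsSmooth f) : IsSmooth (O f) := by
  induction hO with
  | word w h => exact hf.horizWord w
  | add _ _ h1 h2 => exact h1.add h2
  | smul c _ h => exact h.const_smul c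
  | congr _ h ih => rwa [h f hf]

theorem HorizOp.mono {m m' : ℕ} (hm : m ≤ m') {O : (Sph n → ℂ) → Sph n → ℂ}
    (hO : HorizOp m O) : HorizOp m' O := by
  induction hO with
  | word w h => exact .word w (h.trans hm)
  | add _ _ h1 h2 => exact h1.add h2
  | smul c _ h => exact h.smul c
  | congr _ h ih => exact ih.congr h

theorem HorizOp.comp {m m' : ℕ} {O U : (Sph n → ℂ) → Sph n → ℂ} (hO : HorizOp m O)
    (hU : HorizOp m' U) : HorizOp (m + m') (fun f => O (U f)) := by
  induction hO with
  | word w h =>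
    induction hU with
    | word w' h' =>
      refine (HorizOp.word (w ++ w') (by simpa using by omega)).congr fun f _ => ?_
      rw [horizWord_append]
    | add hO hU h1 h2 =>
      exact (h1.add h2).congr fun f hf => horizWord_add w (hO.isSmooth hf) (hU.isSmooth hf)
    | smul c hO h1 => exact (h1.smul c).congr fun f hf => horizWord_const_smul w c (hO.isSmooth hf)
    | congr _ h1 ih => exact ih.congr fun f hf => by rw [h1 f hf]
  | add _ _ h1 h2 => exact h1.add h2
  | smul c _ h => exact h.smul c
  | congr _ h ih => exact ih.congr fun f hf => h _ (hU.isSmooth hf)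

theorem HorizOp.sum {m : ℕ} {ι : Type*} (s : Finset ι) {O : ι → (Sph n → ℂ) → Sph n → ℂ}
    (h : ∀ i, HorizOp m (O i)) : HorizOp m (fun f => ∑ i ∈ s, O i f) := by
  classical
  induction s using Finset.induction_on with
  | empty => exact ((HorizOp.word [] (Nat.zero_le m)).smul 0).congr fun f _ => by simp
  | insert i s hi ih =>
    simp only [Finset.sum_insert hi]
    exact (h i).add ih

theorem horizOp_horiz_horiz (a b : Label n) : HorizOp 2 (fun f => horiz a (horiz b f)) :=
  HorizOp.word [a, b] le_rfl

theorem horizOp_subLaplacian : HorizOp (n := n) 2 subLaplacian :=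
  ((HorizOp.sum Finset.univ fun j => HorizOp.sum Finset.univ fun l =>
    (horizOp_horiz_horiz (j, l, false) (j, l, true)).add
      (horizOp_horiz_horiz (j, l, true) (j, l, false))).smul (-(1 / 2))).congr
    fun f _ => subLaplacian_eq f

/-- T counts as order two. The assumption on n is essential: on the circle there are no nonzero
horizontal fields. -/
theorem horizOp_reeb (hn : n ≠ 0) : HorizOp (n := n) 2 reeb := by
  refine ((HorizOp.sum Finset.univ fun j => HorizOp.sum Finset.univ fun l =>
    (horizOp_horiz_horiz (j, l, false) (j, l, true)).add
      ((horizOp_horiz_horiz (j, l, true) (j, l, false)).smul (-1))).smul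
      (Complex.I / (2 * n))).congr fun f hf => ?_
  simp only [neg_one_smul, ← sub_eq_add_neg]
  rw [sum_horiz_commutator hf, smul_smul]
  have hn' : (n : ℂ) ≠ 0 := Nat.cast_ne_zero.mpr hn
  have : Complex.I / (2 * n) * (-2 * n * Complex.I) = 1 := by
    field_simp
    simp
  rw [this, one_smul]

theorem horizOp_Lop (hn : n ≠ 0) (μ : ℝ) : HorizOp (n := n) 2 (Lop μ) :=
  ((horizOp_subLaplacian.smul _).add (((horizOp_reeb hn).smul _).add
    ((HorizOp.word [] (Nat.zero_le 2)).smul _))).congr fun f _ => Lop_eq μ f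

theorem horizOp_gjms (hn : n ≠ 0) (k : ℕ) : HorizOp (n := n) (2 * k) (gjms k) := by
  have h : ∀ l : List ℝ, HorizOp (n := n) (2 * l.length) (LopList l) := fun l => by
    induction l with
    | nil => exact HorizOp.word [] le_rfl
    | cons μ l ih => exact ((horizOp_Lop hn μ).comp ih).mono (by simp; omega)
  have h' := h (gjmsParams k)
  rw [gjmsParams, List.length_map, List.length_range] at h'
  exact h'.congr fun f _ => gjms_eq k f

/-! ### The Folland–Stein norm -/

/-- The `L²` seminorm of the weak derivative `X_w F`. -/
def wordNorm (w : List (Label n)) (F : Sph n → ℂ) : ℝ≥0∞ :=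
  ⨅ (G : Sph n → ℂ) (_ : IsWeakDeriv w F G), eLpNorm G 2 (vol n)

theorem fsNorm_eq (k : ℕ) (F : Sph n → ℂ) : fsNorm k F =
    ∑ m ∈ Finset.range (k + 1), ∑ a : Fin m → Label n, wordNorm (List.ofFn a) F := rfl

theorem wordNorm_le {w : List (Label n)} {F G : Sph n → ℂ} (h : IsWeakDeriv w F G) :
    wordNorm w F ≤ eLpNorm G 2 (vol n) :=
  iInf₂_le G h

theorem wordNorm_le_fsNorm {k : ℕ} {w : List (Label n)} (hw : w.length ≤ k) (F : Sph n → ℂ) :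
    wordNorm w F ≤ fsNorm k F := by
  rw [fsNorm_eq]
  refine le_trans ?_ (Finset.single_le_sum (f := fun m => ∑ a : Fin m → Label n,
    wordNorm (List.ofFn a) F) (fun _ _ => zero_le) (Finset.mem_range.mpr (Nat.lt_succ_of_le hw)))
  refine le_trans (le_of_eq ?_) (Finset.single_le_sum (f := fun a : Fin w.length → Label n =>
    wordNorm (List.ofFn a) F) (fun _ _ => zero_le) (Finset.mem_univ w.get))
  simp only [List.ofFn_get]

theorem IsSmooth.memLp {f : Sph n → ℂ} (hf : IsSmooth f) (p : ℝ≥0∞) : MemLp f p (vol n) :=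
  hf.continuous.memLp_of_hasCompactSupport (HasCompactSupport.of_compactSpace f)

theorem integrable_mul_of_memLp {f g : Sph n → ℂ} (hf : MemLp f 2 (vol n))
    (hg : MemLp g 2 (vol n)) : Integrable (fun ξ => f ξ * g ξ) (vol n) :=
  hf.integrable_mul hg

theorem norm_integral_mul_le {f g : Sph n → ℂ} (hf : MemLp f 2 (vol n))
    (hg : MemLp g 2 (vol n)) : ‖∫ ξ, f ξ * g ξ ∂(vol n)‖ ≤
      (eLpNorm f 2 (vol n)).toReal * (eLpNorm g 2 (vol n)).toReal := by
  have h := norm_inner_le_norm (𝕜 := ℂ) (hf.star.toLp (star f)) (hg.toLp g)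
  rw [L2.inner_def, Lp.norm_toLp, Lp.norm_toLp] at h
  have e1 : eLpNorm (star f) 2 (vol n) = eLpNorm f 2 (vol n) :=
    eLpNorm_congr_norm_ae (Eventually.of_forall fun ξ => by simp)
  rw [e1] at h
  refine le_trans (le_of_eq ?_) h
  congr 1
  refine integral_congr_ae ?_
  filter_upwards [hf.star.coeFn_toLp, hg.coeFn_toLp] with ξ h1 h2
  rw [h1, h2]
  simp [mul_comm]

theorem isWeakDeriv_horizWord (w : List (Label n)) {φ : Sph n → ℂ} (hφ : IsSmooth φ) :
    IsWeakDeriv w φ (horizWord w φ) := by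
  refine ⟨hφ.memLp 2, (hφ.horizWord w).memLp 2, fun ψ hψ => ?_⟩
  have := (isTransp_horizWord w).integral_eq ψ φ hψ hφ
  simpa only [mul_comm] using this

theorem integral_mul_star_self {f : Sph n → ℂ} (hf : MemLp f 2 (vol n)) :
    ‖∫ ξ, f ξ * star (f ξ) ∂(vol n)‖ = (eLpNorm f 2 (vol n)).toReal ^ 2 := by
  have h := inner_self_eq_norm_sq_to_K (𝕜 := ℂ) (hf.toLp f)
  rw [L2.inner_def, Lp.norm_toLp] at h
  have e : ∫ ξ, f ξ * star (f ξ) ∂(vol n) =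
      ∫ ξ, inner ℂ (hf.toLp f ξ) (hf.toLp f ξ) ∂(vol n) := by
    refine integral_congr_ae ?_
    filter_upwards [hf.coeFn_toLp] with ξ h1
    rw [h1]
    simp [Complex.mul_conj, Complex.normSq_eq_norm_sq]
  rw [e, h]
  simp

/-- Testing both weak derivatives against the conjugate of X_w φ and applying Cauchy–Schwarz gives
‖X_w φ‖² ≤ ‖G‖ ‖X_w φ‖. This identifies the infimum in the norm for smooth functions without the
density of smooth functions in L². -/
theorem eLpNorm_horizWord_le {w : List (Label n)} {φ G : Sph n → ℂ} (hφ : IsSmooth φ)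
    (hG : IsWeakDeriv w φ G) : eLpNorm (horizWord w φ) 2 (vol n) ≤ eLpNorm G 2 (vol n) := by
  have hs := hφ.horizWord w
  have h1 : ∫ ξ, G ξ * star (horizWord w φ) ξ ∂(vol n) =
      ∫ ξ, horizWord w φ ξ * star (horizWord w φ ξ) ∂(vol n) := by
    rw [hG.2.2 _ hs.star, ← (isWeakDeriv_horizWord w hφ).2.2 _ hs.star]
    rfl
  have h2 := norm_integral_mul_le hG.2.1 (hs.star.memLp 2)
  have e1 : eLpNorm (star (horizWord w φ)) 2 (vol n) = eLpNorm (horizWord w φ) 2 (vol n) :=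
    eLpNorm_congr_norm_ae (Eventually.of_forall fun ξ => by simp)
  rw [h1, integral_mul_star_self (hs.memLp 2), e1, sq] at h2
  rw [← ENNReal.toReal_le_toReal (hs.memLp 2).2.ne hG.2.1.2.ne]
  by_contra! hlt
  have hpos := ENNReal.toReal_nonneg.trans_lt hlt
  exact absurd (le_of_mul_le_mul_right h2 hpos) (not_le.mpr hlt)

theorem wordNorm_of_isSmooth (w : List (Label n)) {φ : Sph n → ℂ} (hφ : IsSmooth φ) :
    wordNorm w φ = eLpNorm (horizWord w φ) 2 (vol n) :=
  le_antisymm (wordNorm_le (isWeakDeriv_horizWord w hφ))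
    (le_iInf₂ fun _ hG => eLpNorm_horizWord_le hφ hG)

theorem fsNorm_ne_top (k : ℕ) {φ : Sph n → ℂ} (hφ : IsSmooth φ) : fsNorm k φ ≠ ⊤ := by
  rw [fsNorm_eq]
  refine (ENNReal.sum_lt_top.mpr fun m _ => ENNReal.sum_lt_top.mpr fun a _ => ?_).ne
  rw [wordNorm_of_isSmooth _ hφ]
  exact ((hφ.horizWord _).memLp 2).2

theorem toReal_eLpNorm_horizWord_le {k : ℕ} {w : List (Label n)} (hw : w.length ≤ k)
    {φ : Sph n → ℂ} (hφ : IsSmooth φ) :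
    (eLpNorm (horizWord w φ) 2 (vol n)).toReal ≤ (fsNorm k φ).toReal := by
  rw [← wordNorm_of_isSmooth w hφ]
  exact ENNReal.toReal_mono (fsNorm_ne_top k hφ) (wordNorm_le_fsNorm hw φ)

theorem IsWeakDeriv.add {w : List (Label n)} {F F' G G' : Sph n → ℂ} (h : IsWeakDeriv w F G)
    (h' : IsWeakDeriv w F' G') : IsWeakDeriv w (F + F') (G + G') := by
  refine ⟨h.1.add h'.1, h.2.1.add h'.2.1, fun φ hφ => ?_⟩
  simp only [Pi.add_apply, add_mul]
  rw [integral_add (integrable_mul_of_memLp h.2.1 (hφ.memLp 2))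
    (integrable_mul_of_memLp h'.2.1 (hφ.memLp 2)),
    integral_add (integrable_mul_of_memLp h.1 ((hφ.horizWord _).memLp 2))
    (integrable_mul_of_memLp h'.1 ((hφ.horizWord _).memLp 2)), h.2.2 φ hφ, h'.2.2 φ hφ, mul_add]

theorem IsWeakDeriv.const_smul {w : List (Label n)} {F G : Sph n → ℂ} (c : ℂ)
    (h : IsWeakDeriv w F G) : IsWeakDeriv w (c • F) (c • G) := by
  refine ⟨h.1.const_smul c, h.2.1.const_smul c, fun φ hφ => ?_⟩
  simp only [Pi.smul_apply, smul_eq_mul, mul_assoc]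
  rw [integral_const_mul, integral_const_mul, h.2.2 φ hφ]
  ring

theorem IsWeakDeriv.star {w : List (Label n)} {F G : Sph n → ℂ}
    (h : IsWeakDeriv (w.map Label.conj) F G) : IsWeakDeriv w (star F) (star G) := by
  refine ⟨h.1.star, h.2.1.star, fun φ hφ => ?_⟩
  have h1 := h.2.2 _ hφ.star
  have e : ((w.map Label.conj).reverse.map Label.conj) = w.reverse := by
    rw [← List.map_reverse, List.map_map]
    convert List.map_id _
    ext1 a
    exact a.conj_conj
  rw [horizWord_star _ hφ, e] at h1
  have h2 := congrArg (starRingEnd ℂ) h1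
  rw [map_mul, ← integral_conj, ← integral_conj] at h2
  simpa using h2

theorem wordNorm_add_le (w : List (Label n)) (F G : Sph n → ℂ) :
    wordNorm w (F + G) ≤ wordNorm w F + wordNorm w G := by
  simp only [wordNorm, ENNReal.iInf_add, ENNReal.add_iInf, le_iInf_iff]
  intro F' hF' G' hG'
  exact (wordNorm_le (hG'.add hF')).trans
    (eLpNorm_add_le hG'.2.1.1 hF'.2.1.1 (by norm_num))

theorem wordNorm_const_smul_le (w : List (Label n)) (c : ℂ) (F : Sph n → ℂ) :
    wordNorm w (c • F) ≤ ‖c‖ₑ * wordNorm w F := by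
  -- For c = 0 the right side is 0 even when the norm of F is infinite, and pulling the factor out
  -- of the infimum fails; the norm of the zero function is computed directly.
  rcases eq_or_ne c 0 with rfl | hc
  · rw [zero_smul, wordNorm_of_isSmooth w isSmooth_zero]
    have := horizWord_const_smul w 0 (isSmooth_zero (n := n))
    rw [zero_smul, zero_smul] at this
    simp [this]
  · simp only [wordNorm]
    rw [ENNReal.mul_iInf_of_ne (by simpa using hc) (by simp)]
    refine le_iInf fun G => ?_
    rw [ENNReal.mul_iInf_of_ne (by simpa using hc) (by simp)]
    refine le_iInf fun hG => ?_
    rw [← eLpNorm_const_smul]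
    exact wordNorm_le (hG.const_smul c)

theorem wordNorm_star_le (w : List (Label n)) (F : Sph n → ℂ) :
    wordNorm w (star F) ≤ wordNorm (w.map Label.conj) F := by
  refine le_iInf₂ fun G hG => (wordNorm_le hG.star).trans (le_of_eq ?_)
  exact eLpNorm_congr_norm_ae (Eventually.of_forall fun ξ => by simp)

theorem fsNorm_add_le (k : ℕ) (F G : Sph n → ℂ) :
    fsNorm k (F + G) ≤ fsNorm k F + fsNorm k G := by
  simp only [fsNorm_eq, ← Finset.sum_add_distrib]
  exact Finset.sum_le_sum fun m _ => Finset.sum_le_sum fun a _ => wordNorm_add_le _ F G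

theorem fsNorm_const_smul_le (k : ℕ) (c : ℂ) (F : Sph n → ℂ) :
    fsNorm k (c • F) ≤ ‖c‖ₑ * fsNorm k F := by
  simp only [fsNorm_eq, Finset.mul_sum]
  exact Finset.sum_le_sum fun m _ => Finset.sum_le_sum fun a _ => wordNorm_const_smul_le _ c F

theorem fsNorm_sub_comm_le (k : ℕ) (F G : Sph n → ℂ) : fsNorm k (F - G) ≤ fsNorm k (G - F) := by
  have := fsNorm_const_smul_le k (-1) (G - F)
  simpa using this

theorem fsNorm_star_le (k : ℕ) (F : Sph n → ℂ) : fsNorm k (star F) ≤ fsNorm k F := by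
  simp only [fsNorm_eq]
  refine Finset.sum_le_sum fun m _ => ?_
  have hinv : Function.Involutive fun (a : Fin m → Label n) i => (a i).conj := fun a => by
    ext1 i
    exact (a i).conj_conj
  -- Conjugating labels permutes the words of length m, so the sum of norms is unchanged although
  -- single terms are exchanged.
  rw [← Equiv.sum_comp hinv.toPerm fun a => wordNorm (List.ofFn a) F]
  refine Finset.sum_le_sum fun a _ => (wordNorm_star_le _ F).trans (le_of_eq ?_)
  rw [List.map_ofFn]
  rfl

/-! ### Multiplication by smooth functions -/

theorem IsWeakDeriv.append_singleton {w : List (Label n)} {a : Label n} {F G H : Sph n → ℂ}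
    (h : IsWeakDeriv [a] F G) (h' : IsWeakDeriv w G H) : IsWeakDeriv (w ++ [a]) F H := by
  refine ⟨h.1, h'.2.1, fun φ hφ => ?_⟩
  rw [h'.2.2 φ hφ, h.2.2 _ (hφ.horizWord _), List.reverse_append, List.length_append, pow_add,
    mul_assoc]
  rfl

theorem IsWeakDeriv.of_cons {v : List (Label n)} {a : Label n} {F G H : Sph n → ℂ}
    (h : IsWeakDeriv v F G) (h' : IsWeakDeriv (a :: v) F H) : IsWeakDeriv [a] G H := by
  refine ⟨h.2.1, h'.2.1, fun φ hφ => ?_⟩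
  have h1 := h.2.2 _ (hφ.horiz a)
  change _ = _ * ∫ ξ, G ξ * horiz a φ ξ ∂(vol n)
  rw [h1, h'.2.2 φ hφ, List.reverse_cons, horizWord_append, List.length_cons, pow_succ',
    List.length_singleton, pow_one, mul_assoc]
  rfl

theorem memLp_smooth_mul {a F : Sph n → ℂ} (ha : IsSmooth a) (hF : MemLp F 2 (vol n)) :
    MemLp (a * F) 2 (vol n) :=
  hF.mul (ha.memLp ⊤)

theorem IsWeakDeriv.smooth_mul {a F G : Sph n → ℂ} {x : Label n} (ha : IsSmooth a)
    (h : IsWeakDeriv [x] F G) : IsWeakDeriv [x] (a * F) (a * G + horiz x a * F) := by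
  have m1 := memLp_smooth_mul ha h.2.1
  have m2 := memLp_smooth_mul (ha.horiz x) h.1
  refine ⟨memLp_smooth_mul ha h.1, m1.add m2, fun φ hφ => ?_⟩
  have h1 := h.2.2 _ (ha.mul hφ)
  change _ = _ * ∫ ξ, F ξ * horiz x (a * φ) ξ ∂(vol n) at h1
  change _ = _ * ∫ ξ, (a * F) ξ * horiz x φ ξ ∂(vol n)
  rw [horiz_mul x ha hφ] at h1
  simp only [Pi.add_apply, Pi.mul_apply, mul_add, add_mul] at h1 ⊢
  have i1 : Integrable (fun ξ => a ξ * G ξ * φ ξ) (vol n) :=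
    integrable_mul_of_memLp m1 (hφ.memLp 2)
  have i2 : Integrable (fun ξ => horiz x a ξ * F ξ * φ ξ) (vol n) :=
    integrable_mul_of_memLp m2 (hφ.memLp 2)
  have i3 : Integrable (fun ξ => F ξ * (a ξ * horiz x φ ξ)) (vol n) :=
    integrable_mul_of_memLp h.1 ((ha.mul (hφ.horiz x)).memLp 2)
  have i4 : Integrable (fun ξ => F ξ * (horiz x a ξ * φ ξ)) (vol n) :=
    integrable_mul_of_memLp h.1 (((ha.horiz x).mul hφ).memLp 2)
  rw [integral_add i1 i2]
  rw [integral_add i3 i4] at h1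
  have e1 : ∀ ξ, a ξ * G ξ * φ ξ = G ξ * (a ξ * φ ξ) := fun ξ => by ring
  have e2 : ∀ ξ, horiz x a ξ * F ξ * φ ξ = F ξ * (horiz x a ξ * φ ξ) := fun ξ => by ring
  have e3 : ∀ ξ, a ξ * F ξ * horiz x φ ξ = F ξ * (a ξ * horiz x φ ξ) := fun ξ => by ring
  simp only [e1, e2, e3, h1, List.length_singleton, pow_one]
  ring

theorem exists_bound_of_isSmooth {a : Sph n → ℂ} (ha : IsSmooth a) :
    ∃ C : ℝ, ∀ ξ, ‖a ξ‖ ≤ C := by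
  obtain ⟨C, hC⟩ := isCompact_univ.exists_bound_of_continuousOn ha.continuous.continuousOn
  exact ⟨C, fun ξ => hC ξ trivial⟩

/-- Leibniz rule by induction, removing the innermost field x: X_w x (a G_v) = X_w (a G_{xv}) + X_w
((xa) G_v). The multiplier changes to xa and the word v grows, so both are quantified inside the
induction; C depends on w and a only. -/
theorem exists_isWeakDeriv_smooth_mul (w : List (Label n)) : ∀ {a : Sph n → ℂ}, IsSmooth a →
    ∃ C : ℝ≥0∞, C ≠ ⊤ ∧ ∀ (k : ℕ) (F : Sph n → ℂ) (G : List (Label n) → Sph n → ℂ) (ε : ℝ≥0∞),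
      (∀ v : List (Label n), v.length ≤ k →
        IsWeakDeriv v F (G v) ∧ eLpNorm (G v) 2 (vol n) ≤ ε) →
      ∀ v : List (Label n), w.length + v.length ≤ k →
        ∃ H, IsWeakDeriv w (a * G v) H ∧ eLpNorm H 2 (vol n) ≤ C * ε := by
  induction w using List.reverseRecOn with
  | nil =>
    intro a ha
    obtain ⟨C, hC⟩ := exists_bound_of_isSmooth ha
    refine ⟨ENNReal.ofReal C, ENNReal.ofReal_ne_top, fun k F G ε hG v hv => ?_⟩
    obtain ⟨h1, h2⟩ := hG v (by simpa using hv)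
    have hm := memLp_smooth_mul ha h1.2.1
    refine ⟨a * G v, ⟨hm, hm, fun φ _ => by simp [horizWord]⟩, ?_⟩
    refine (eLpNorm_le_mul_eLpNorm_of_ae_le_mul (g := G v) (Eventually.of_forall fun ξ => ?_)
      2).trans (mul_le_mul_right h2 _)
    rw [Pi.mul_apply, norm_mul]
    exact mul_le_mul_of_nonneg_right (hC ξ) (norm_nonneg _)
  | append_singleton w x ih =>
    intro a ha
    obtain ⟨C₁, hC₁, h₁⟩ := ih ha
    obtain ⟨C₂, hC₂, h₂⟩ := ih (ha.horiz x)
    refine ⟨C₁ + C₂, ENNReal.add_ne_top.mpr ⟨hC₁, hC₂⟩, fun k F G ε hG v hv => ?_⟩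
    rw [List.length_append, List.length_singleton] at hv
    obtain ⟨H₁, hH₁, hn₁⟩ := h₁ k F G ε hG (x :: v) (by rw [List.length_cons]; omega)
    obtain ⟨H₂, hH₂, hn₂⟩ := h₂ k F G ε hG v (by omega)
    have hx : IsWeakDeriv [x] (G v) (G (x :: v)) :=
      (hG v (by omega)).1.of_cons (hG (x :: v) (by rw [List.length_cons]; omega)).1
    refine ⟨H₁ + H₂, (hx.smooth_mul ha).append_singleton (hH₁.add hH₂), ?_⟩
    refine (eLpNorm_add_le hH₁.2.1.1 hH₂.2.1.1 (by norm_num)).trans ?_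
    rw [add_mul]
    exact add_le_add hn₁ hn₂

/-- The representative chosen for the empty word agrees with F only when tested against smooth
functions, so derivatives of aG must be transferred to aF. -/
theorem IsWeakDeriv.congr_nil {w : List (Label n)} {a F G H : Sph n → ℂ} (ha : IsSmooth a)
    (h : IsWeakDeriv [] F G) (hH : IsWeakDeriv w (a * G) H) : IsWeakDeriv w (a * F) H := by
  refine ⟨memLp_smooth_mul ha h.1, hH.2.1, fun φ hφ => ?_⟩
  rw [hH.2.2 φ hφ]
  have h1 := h.2.2 _ (ha.mul (hφ.horizWord w.reverse))
  simp only [List.length_nil, pow_zero, one_mul, List.reverse_nil] at h1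
  change _ = ∫ ξ, F ξ * (a * horizWord w.reverse φ) ξ ∂(vol n) at h1
  simp only [Pi.mul_apply, mul_comm (a _), mul_assoc] at h1 ⊢
  rw [h1]

theorem fsNorm_smooth_mul_le (k : ℕ) {a : Sph n → ℂ} (ha : IsSmooth a) :
    ∃ C : ℝ≥0∞, C ≠ ⊤ ∧ ∀ F, fsNorm k (a * F) ≤ C * fsNorm k F := by
  choose C hC h using fun w : List (Label n) => exists_isWeakDeriv_smooth_mul w ha
  -- The summand 1 keeps K nonzero, so that the bound can be divided by K.
  obtain ⟨K, hK⟩ : ∃ K, K = 1 + ∑ m ∈ Finset.range (k + 1), ∑ b : Fin m → Label n,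
    C (List.ofFn b) := ⟨_, rfl⟩
  have hK0 : K ≠ 0 := by simp [hK]
  have hKt : K ≠ ⊤ := by
    rw [hK]
    exact ENNReal.add_ne_top.mpr ⟨ENNReal.one_ne_top, (ENNReal.sum_lt_top.mpr fun m _ =>
      ENNReal.sum_lt_top.mpr fun b _ => (hC _).lt_top).ne⟩
  refine ⟨K, hKt, fun F => ?_⟩
  rw [mul_comm K, ← ENNReal.div_le_iff_le_mul (Or.inl hK0) (Or.inl hKt)]
  -- No claim is made that the infima are attained: for each ε above the norm of F there are weak
  -- derivatives of L² norm at most ε. If the norm is infinite, no such ε exists.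
  refine le_of_forall_gt_imp_ge_of_dense fun ε hε => ?_
  rw [ENNReal.div_le_iff_le_mul (Or.inl hK0) (Or.inl hKt)]
  have hG : ∀ v : List (Label n), ∃ G, v.length ≤ k →
      IsWeakDeriv v F G ∧ eLpNorm G 2 (vol n) ≤ ε := fun v => by
    by_cases hv : v.length ≤ k
    · obtain ⟨G, hG'⟩ := iInf_lt_iff.mp ((wordNorm_le_fsNorm hv F).trans_lt hε)
      obtain ⟨hG, hlt⟩ := iInf_lt_iff.mp hG'
      exact ⟨G, fun _ => ⟨hG, hlt.le⟩⟩
    · exact ⟨0, fun h => absurd h hv⟩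
  choose G hG using hG
  have hword : ∀ w : List (Label n), w.length ≤ k → wordNorm w (a * F) ≤ C w * ε := fun w hw => by
    obtain ⟨H, hH, hn⟩ := h w k F G ε hG [] (by simpa using hw)
    exact (wordNorm_le ((hG [] (Nat.zero_le k)).1.congr_nil ha hH)).trans hn
  calc fsNorm k (a * F)
      ≤ ∑ m ∈ Finset.range (k + 1), ∑ b : Fin m → Label n, C (List.ofFn b) * ε := by
        rw [fsNorm_eq]
        refine Finset.sum_le_sum fun m hm => Finset.sum_le_sum fun b _ => hword _ ?_
        rw [List.length_ofFn]
        exact Nat.lt_succ_iff.mp (Finset.mem_range.mp hm)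
    _ = (∑ m ∈ Finset.range (k + 1), ∑ b : Fin m → Label n, C (List.ofFn b)) * ε := by
        simp only [Finset.sum_mul]
    _ ≤ ε * K := by
        rw [mul_comm, hK]
        exact mul_le_mul_right le_add_self _

/-! ### The pairing `⟨P_k F, G⟩` -/

/-- The bilinear form `(φ, ψ) ↦ ∫ ψ P_k φ dξ`. -/
def gjmsForm (k : ℕ) (φ ψ : Sph n → ℂ) : ℂ := ∫ ξ, ψ ξ * gjms k φ ξ ∂(vol n)

theorem HorizOp.exists_bound {m k : ℕ} (hm : m ≤ 2 * k) {O : (Sph n → ℂ) → Sph n → ℂ}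
    (hO : HorizOp m O) : ∃ C : ℝ, 0 ≤ C ∧ ∀ φ ψ, IsSmooth φ → IsSmooth ψ →
      ‖∫ ξ, ψ ξ * O φ ξ ∂(vol n)‖ ≤ C * (fsNorm k φ).toReal * (fsNorm k ψ).toReal := by
  induction hO with
  | word w hw =>
    refine ⟨1, zero_le_one, fun φ ψ hφ hψ => ?_⟩
    -- The first k letters move to ψ, and at most k of the 2k remain on φ.
    have h := (isTransp_horizWord (w.take k)).integral_eq ψ (horizWord (w.drop k) φ) hψ
      (hφ.horizWord _)
    rw [← horizWord_append, List.take_append_drop] at h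
    rw [h, norm_mul, norm_pow, norm_neg, norm_one, one_pow, one_mul, one_mul, mul_comm]
    refine (norm_integral_mul_le ((hψ.horizWord _).memLp 2) ((hφ.horizWord _).memLp 2)).trans ?_
    refine mul_le_mul (toReal_eLpNorm_horizWord_le ?_ hψ) (toReal_eLpNorm_horizWord_le ?_ hφ)
      ENNReal.toReal_nonneg ENNReal.toReal_nonneg
    · rw [List.length_reverse, List.length_take]
      exact min_le_left _ _
    · rw [List.length_drop]
      omega
  | add hO hU h1 h2 =>
    obtain ⟨C₁, hC₁, h₁⟩ := h1
    obtain ⟨C₂, hC₂, h₂⟩ := h2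
    refine ⟨C₁ + C₂, add_nonneg hC₁ hC₂, fun φ ψ hφ hψ => ?_⟩
    simp only [Pi.add_apply, mul_add]
    rw [integral_add (hψ.integrable_mul (hO.isSmooth hφ)) (hψ.integrable_mul (hU.isSmooth hφ)),
      add_mul, add_mul]
    exact (norm_add_le _ _).trans (add_le_add (h₁ φ ψ hφ hψ) (h₂ φ ψ hφ hψ))
  | smul c hO h1 =>
    obtain ⟨C, hC, h⟩ := h1
    refine ⟨‖c‖ * C, by positivity, fun φ ψ hφ hψ => ?_⟩
    simp only [Pi.smul_apply, smul_eq_mul, mul_left_comm _ c]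
    rw [integral_const_mul, norm_mul, mul_assoc, mul_assoc, ← mul_assoc C]
    exact mul_le_mul_of_nonneg_left (h φ ψ hφ hψ) (norm_nonneg c)
  | congr hO h ih =>
    obtain ⟨C, hC, h'⟩ := ih
    refine ⟨C, hC, fun φ ψ hφ hψ => ?_⟩
    rw [h φ hφ]
    exact h' φ ψ hφ hψ

theorem gjmsForm_bound (hn : n ≠ 0) (k : ℕ) : ∃ C : ℝ, 0 ≤ C ∧ ∀ φ ψ : Sph n → ℂ, IsSmooth φ →
    IsSmooth ψ → ‖gjmsForm k φ ψ‖ ≤ C * (fsNorm k φ).toReal * (fsNorm k ψ).toReal :=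
  (horizOp_gjms hn k).exists_bound le_rfl

theorem gjmsForm_comm (k : ℕ) {φ ψ : Sph n → ℂ} (hφ : IsSmooth φ) (hψ : IsSmooth ψ) :
    gjmsForm k φ ψ = gjmsForm k ψ φ :=
  integral_mul_gjms k hψ hφ

theorem gjmsForm_add_right (k : ℕ) {φ ψ ψ' : Sph n → ℂ} (hφ : IsSmooth φ) (hψ : IsSmooth ψ)
    (hψ' : IsSmooth ψ') : gjmsForm k φ (ψ + ψ') = gjmsForm k φ ψ + gjmsForm k φ ψ' := by
  simp only [gjmsForm, Pi.add_apply, add_mul]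
  exact integral_add (hψ.integrable_mul (hφ.gjms k)) (hψ'.integrable_mul (hφ.gjms k))

theorem gjmsForm_smul_right (k : ℕ) (c : ℂ) (φ ψ : Sph n → ℂ) :
    gjmsForm k φ (c • ψ) = c * gjmsForm k φ ψ := by
  simp only [gjmsForm, Pi.smul_apply, smul_eq_mul, mul_assoc]
  exact integral_const_mul _ _

theorem gjmsForm_star (k : ℕ) {φ ψ : Sph n → ℂ} (hφ : IsSmooth φ) :
    gjmsForm k (star φ) (star ψ) = starRingEnd ℂ (gjmsForm k φ ψ) := by
  rw [gjmsForm, gjms_star k hφ, gjmsForm, ← integral_conj]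
  simp

/-- Additivity in the first slot is obtained from the second by symmetry of the form. -/
theorem gjmsForm_sub (k : ℕ) {φ φ' ψ ψ' : Sph n → ℂ} (hφ : IsSmooth φ) (hφ' : IsSmooth φ')
    (hψ : IsSmooth ψ) (hψ' : IsSmooth ψ') : gjmsForm k φ ψ - gjmsForm k φ' ψ' =
      gjmsForm k (φ - φ') ψ + gjmsForm k φ' (ψ - ψ') := by
  have h1 := gjmsForm_add_right k hψ (hφ.sub hφ') hφ'
  have h2 := gjmsForm_add_right k hφ' (hψ.sub hψ') hψ'
  rw [sub_add_cancel, gjmsForm_comm k hψ hφ, gjmsForm_comm k hψ (hφ.sub hφ'),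
    gjmsForm_comm k hψ hφ'] at h1
  rw [sub_add_cancel] at h2
  linear_combination h1 + h2

/-- The smooth functions `φ i` converge to `F` in `S^{k,2}`. -/
def FSConv (k : ℕ) (φ : ℕ → Sph n → ℂ) (F : Sph n → ℂ) : Prop :=
  (∀ i, IsSmooth (φ i)) ∧ Tendsto (fun i => fsNorm k (φ i - F)) atTop (𝓝 0)

theorem MemFS.exists_fsConv {k : ℕ} {F : Sph n → ℂ} (hF : MemFS k F) : ∃ φ, FSConv k φ F := by
  choose φ hφ using fun i : ℕ => hF ((i : ℝ≥0∞) + 1)⁻¹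
    (ENNReal.inv_pos.mpr (ENNReal.add_ne_top.mpr ⟨ENNReal.natCast_ne_top i, ENNReal.one_ne_top⟩))
  refine ⟨φ, fun i => (hφ i).1, ?_⟩
  have h : Tendsto (fun i : ℕ => ((i : ℝ≥0∞) + 1)⁻¹) atTop (𝓝 0) := by
    have := (tendsto_add_atTop_iff_nat 1).mpr ENNReal.tendsto_inv_nat_nhds_zero
    simpa using this
  exact tendsto_of_tendsto_of_tendsto_of_le_of_le tendsto_const_nhds h (fun _ => zero_le)
    fun i => (hφ i).2.le

theorem FSConv.memFS {k : ℕ} {φ : ℕ → Sph n → ℂ} {F : Sph n → ℂ} (h : FSConv k φ F) :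
    MemFS k F := fun ε hε => by
  obtain ⟨i, hi⟩ := (h.2.eventually (gt_mem_nhds hε)).exists
  exact ⟨φ i, h.1 i, hi⟩

theorem FSConv.of_le {k : ℕ} {φ ψ : ℕ → Sph n → ℂ} {F G : Sph n → ℂ} (h : FSConv k φ F)
    (hψ : ∀ i, IsSmooth (ψ i)) {C : ℝ≥0∞} (hC : C ≠ ⊤)
    (hle : ∀ i, fsNorm k (ψ i - G) ≤ C * fsNorm k (φ i - F)) : FSConv k ψ G := by
  refine ⟨hψ, tendsto_of_tendsto_of_tendsto_of_le_of_le tendsto_const_nhds ?_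
    (fun _ => zero_le) hle⟩
  simpa using ENNReal.Tendsto.const_mul h.2 (Or.inr hC)

theorem FSConv.add {k : ℕ} {φ ψ : ℕ → Sph n → ℂ} {F G : Sph n → ℂ} (hφ : FSConv k φ F)
    (hψ : FSConv k ψ G) : FSConv k (fun i => φ i + ψ i) (F + G) := by
  refine ⟨fun i => (hφ.1 i).add (hψ.1 i), tendsto_of_tendsto_of_tendsto_of_le_of_le
    tendsto_const_nhds (by simpa using hφ.2.add hψ.2) (fun _ => zero_le) fun i => ?_⟩
  dsimp only
  rw [add_sub_add_comm]
  exact fsNorm_add_le k _ _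

theorem FSConv.const_smul {k : ℕ} {φ : ℕ → Sph n → ℂ} {F : Sph n → ℂ} (c : ℂ)
    (hφ : FSConv k φ F) : FSConv k (fun i => c • φ i) (c • F) :=
  hφ.of_le (fun i => (hφ.1 i).const_smul c) (C := ‖c‖ₑ) (by simp) fun i => by
    rw [← smul_sub]
    exact fsNorm_const_smul_le k c _

theorem FSConv.star {k : ℕ} {φ : ℕ → Sph n → ℂ} {F : Sph n → ℂ} (hφ : FSConv k φ F) :
    FSConv k (fun i => star (φ i)) (star F) :=
  hφ.of_le (fun i => (hφ.1 i).star) ENNReal.one_ne_top fun i => by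
    rw [← star_sub, one_mul]
    exact fsNorm_star_le k _

theorem FSConv.smooth_mul {k : ℕ} {φ : ℕ → Sph n → ℂ} {F a : Sph n → ℂ} (ha : IsSmooth a)
    (hφ : FSConv k φ F) : FSConv k (fun i => a * φ i) (a * F) := by
  obtain ⟨C, hC, h⟩ := fsNorm_smooth_mul_le k ha
  refine hφ.of_le (fun i => ha.mul (hφ.1 i)) hC fun i => ?_
  rw [← mul_sub]
  exact h _

theorem MemFS.add {k : ℕ} {F G : Sph n → ℂ} (hF : MemFS k F) (hG : MemFS k G) :
    MemFS k (F + G) := by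
  obtain ⟨φ, hφ⟩ := hF.exists_fsConv
  obtain ⟨ψ, hψ⟩ := hG.exists_fsConv
  exact (hφ.add hψ).memFS

theorem MemFS.const_smul {k : ℕ} {F : Sph n → ℂ} (c : ℂ) (hF : MemFS k F) : MemFS k (c • F) := by
  obtain ⟨φ, hφ⟩ := hF.exists_fsConv
  exact (hφ.const_smul c).memFS

theorem MemFS.smooth_mul {k : ℕ} {F a : Sph n → ℂ} (ha : IsSmooth a) (hF : MemFS k F) :
    MemFS k (a * F) := by
  obtain ⟨φ, hφ⟩ := hF.exists_fsConv
  exact (hφ.smooth_mul ha).memFS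

theorem MemFS.fsNorm_ne_top {k : ℕ} {F : Sph n → ℂ} (hF : MemFS k F) : fsNorm k F ≠ ⊤ := by
  obtain ⟨φ, hφ, h⟩ := hF 1 one_pos
  have h1 := fsNorm_add_le k φ (F - φ)
  rw [add_sub_cancel] at h1
  refine ne_top_of_le_ne_top (ENNReal.add_ne_top.mpr ⟨CRSphere.fsNorm_ne_top k hφ, ?_⟩) h1
  exact ne_top_of_lt ((fsNorm_sub_comm_le k F φ).trans_lt h)

theorem FSConv.tendsto_smoothNhds {k : ℕ} {φ : ℕ → Sph n → ℂ} {F : Sph n → ℂ}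
    (hφ : FSConv k φ F) : Tendsto φ atTop (smoothNhds k F) := by
  simp only [smoothNhds, tendsto_iInf, tendsto_principal]
  intro ε hε
  filter_upwards [hφ.2.eventually (gt_mem_nhds hε)] with i hi
  exact ⟨hφ.1 i, hi⟩

theorem mem_smoothNhds {k : ℕ} (F : Sph n → ℂ) {ε : ℝ≥0∞} (hε : 0 < ε) :
    {φ | IsSmooth φ ∧ fsNorm k (φ - F) < ε} ∈ smoothNhds k F :=
  mem_iInf_of_mem ε (mem_iInf_of_mem hε (mem_principal_self _))

theorem toReal_fsNorm_sub_le {k : ℕ} {F φ φ' : Sph n → ℂ} {δ : ℝ} (hδ : 0 ≤ δ)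
    (h : fsNorm k (φ - F) ≤ ENNReal.ofReal δ) (h' : fsNorm k (φ' - F) ≤ ENNReal.ofReal δ) :
    (fsNorm k (φ - φ')).toReal ≤ 2 * δ := by
  have h1 := fsNorm_add_le k (φ - F) (F - φ')
  rw [sub_add_sub_cancel] at h1
  refine ENNReal.toReal_le_of_le_ofReal (by positivity) (h1.trans ?_)
  rw [two_mul, ENNReal.ofReal_add hδ hδ]
  exact add_le_add h ((fsNorm_sub_comm_le k F φ').trans h')

theorem toReal_fsNorm_le {k : ℕ} {F φ : Sph n → ℂ} {δ : ℝ} (hF : MemFS k F) (hδ : 0 ≤ δ)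
    (h : fsNorm k (φ - F) ≤ ENNReal.ofReal δ) :
    (fsNorm k φ).toReal ≤ δ + (fsNorm k F).toReal := by
  have h1 := fsNorm_add_le k (φ - F) F
  rw [sub_add_cancel] at h1
  refine ENNReal.toReal_le_of_le_ofReal (by positivity) (h1.trans ?_)
  rw [ENNReal.ofReal_add hδ ENNReal.toReal_nonneg, ENNReal.ofReal_toReal hF.fsNorm_ne_top]
  exact add_le_add_left h _

/-- `limUnder` is meaningful only once a limit exists. The bounded form makes the image filter
Cauchy, and ℂ is complete. -/
theorem tendsto_gjmsPairing (hn : n ≠ 0) {k : ℕ} {F G : Sph n → ℂ} (hF : MemFS k F)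
    (hG : MemFS k G) :
    Tendsto (fun q : (Sph n → ℂ) × (Sph n → ℂ) => gjmsForm k q.1 q.2)
      (smoothNhds k F ×ˢ smoothNhds k G) (𝓝 (gjmsPairing k F G)) := by
  obtain ⟨φ₀, hφ₀⟩ := hF.exists_fsConv
  obtain ⟨ψ₀, hψ₀⟩ := hG.exists_fsConv
  have hne : (smoothNhds k F ×ˢ smoothNhds k G).NeBot :=
    (hφ₀.tendsto_smoothNhds.prodMk hψ₀.tendsto_smoothNhds).neBot
  refine tendsto_nhds_limUnder ?_
  rw [← cauchy_map_iff_exists_tendsto, Metric.cauchy_iff]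
  refine ⟨inferInstance, fun ε hε => ?_⟩
  obtain ⟨C, hC, hbound⟩ := gjmsForm_bound hn k
  set M := (fsNorm k F).toReal + (fsNorm k G).toReal + 1 with hM
  have hM0 : 0 < M := by positivity
  obtain ⟨δ, hδ0, hδ1, hδ⟩ : ∃ δ : ℝ, 0 < δ ∧ δ ≤ 1 ∧ 4 * C * M * δ < ε := by
    -- The bound δ ≤ 1 keeps all approximants within norm M; the added 1 avoids division by zero
    -- when C = 0.
    refine ⟨min 1 (ε / (4 * C * M + 1)), by positivity, min_le_left _ _, ?_⟩
    calc 4 * C * M * min 1 (ε / (4 * C * M + 1)) ≤ 4 * C * M * (ε / (4 * C * M + 1)) := by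
          gcongr
          exact min_le_right _ _
      _ < ε := by
          rw [mul_div_assoc', div_lt_iff₀ (by positivity)]
          nlinarith
  have hδ' : 0 < ENNReal.ofReal δ := ENNReal.ofReal_pos.mpr hδ0
  refine ⟨_, image_mem_map (prod_mem_prod (mem_smoothNhds F hδ') (mem_smoothNhds G hδ')), ?_⟩
  rintro _ ⟨⟨φ, ψ⟩, ⟨⟨hφ, hφF⟩, ⟨hψ, hψG⟩⟩, rfl⟩ _ ⟨⟨φ', ψ'⟩, ⟨⟨hφ', hφF'⟩, ⟨hψ', hψG'⟩⟩, rfl⟩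
  dsimp only at *
  rw [dist_eq_norm, gjmsForm_sub k hφ hφ' hψ hψ']
  have b1 := toReal_fsNorm_sub_le hδ0.le hφF.le hφF'.le
  have b2 := toReal_fsNorm_sub_le hδ0.le hψG.le hψG'.le
  have hF0 : 0 ≤ (fsNorm k F).toReal := ENNReal.toReal_nonneg
  have hG0 : 0 ≤ (fsNorm k G).toReal := ENNReal.toReal_nonneg
  have b3 : (fsNorm k ψ).toReal ≤ M := by linarith [toReal_fsNorm_le hG hδ0.le hψG.le]
  have b4 : (fsNorm k φ').toReal ≤ M := by linarith [toReal_fsNorm_le hF hδ0.le hφF'.le]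
  calc ‖gjmsForm k (φ - φ') ψ + gjmsForm k φ' (ψ - ψ')‖
      ≤ C * (fsNorm k (φ - φ')).toReal * (fsNorm k ψ).toReal +
          C * (fsNorm k φ').toReal * (fsNorm k (ψ - ψ')).toReal :=
        (norm_add_le _ _).trans (add_le_add (hbound _ _ (hφ.sub hφ') hψ)
          (hbound _ _ hφ' (hψ.sub hψ')))
    _ ≤ C * (2 * δ) * M + C * M * (2 * δ) := by gcongr
    _ = 4 * C * M * δ := by ring
    _ < ε := hδ

theorem FSConv.tendsto_gjmsForm (hn : n ≠ 0) {k : ℕ} {φ ψ : ℕ → Sph n → ℂ} {F G : Sph n → ℂ}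
    (hφ : FSConv k φ F) (hψ : FSConv k ψ G) :
    Tendsto (fun i => gjmsForm k (φ i) (ψ i)) atTop (𝓝 (gjmsPairing k F G)) :=
  (tendsto_gjmsPairing hn hφ.memFS hψ.memFS).comp
    (hφ.tendsto_smoothNhds.prodMk hψ.tendsto_smoothNhds)

theorem gjmsPairing_comm (hn : n ≠ 0) {k : ℕ} {F G : Sph n → ℂ} (hF : MemFS k F)
    (hG : MemFS k G) : gjmsPairing k F G = gjmsPairing k G F := by
  obtain ⟨φ, hφ⟩ := hF.exists_fsConv
  obtain ⟨ψ, hψ⟩ := hG.exists_fsConv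
  refine tendsto_nhds_unique (hφ.tendsto_gjmsForm hn hψ) ?_
  simp only [fun i => gjmsForm_comm k (hφ.1 i) (hψ.1 i)]
  exact hψ.tendsto_gjmsForm hn hφ

theorem gjmsPairing_add_right (hn : n ≠ 0) {k : ℕ} {F G H : Sph n → ℂ} (hF : MemFS k F)
    (hG : MemFS k G) (hH : MemFS k H) :
    gjmsPairing k F (G + H) = gjmsPairing k F G + gjmsPairing k F H := by
  obtain ⟨φ, hφ⟩ := hF.exists_fsConv
  obtain ⟨ψ, hψ⟩ := hG.exists_fsConv
  obtain ⟨χ, hχ⟩ := hH.exists_fsConv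
  refine tendsto_nhds_unique (hφ.tendsto_gjmsForm hn (hψ.add hχ)) ?_
  simp only [fun i => gjmsForm_add_right k (hφ.1 i) (hψ.1 i) (hχ.1 i)]
  exact (hφ.tendsto_gjmsForm hn hψ).add (hφ.tendsto_gjmsForm hn hχ)

theorem gjmsPairing_smul_right (hn : n ≠ 0) {k : ℕ} (c : ℂ) {F G : Sph n → ℂ} (hF : MemFS k F)
    (hG : MemFS k G) : gjmsPairing k F (c • G) = c * gjmsPairing k F G := by
  obtain ⟨φ, hφ⟩ := hF.exists_fsConv
  obtain ⟨ψ, hψ⟩ := hG.exists_fsConv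
  refine tendsto_nhds_unique (hφ.tendsto_gjmsForm hn (hψ.const_smul c)) ?_
  simp only [gjmsForm_smul_right]
  exact (hφ.tendsto_gjmsForm hn hψ).const_mul c

theorem gjmsPairing_add_left (hn : n ≠ 0) {k : ℕ} {F G H : Sph n → ℂ} (hF : MemFS k F)
    (hG : MemFS k G) (hH : MemFS k H) :
    gjmsPairing k (F + G) H = gjmsPairing k F H + gjmsPairing k G H := by
  rw [gjmsPairing_comm hn (hF.add hG) hH, gjmsPairing_add_right hn hH hF hG,
    gjmsPairing_comm hn hH hF, gjmsPairing_comm hn hH hG]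

theorem gjmsPairing_smul_left (hn : n ≠ 0) {k : ℕ} (c : ℂ) {F G : Sph n → ℂ} (hF : MemFS k F)
    (hG : MemFS k G) : gjmsPairing k (c • F) G = c * gjmsPairing k F G := by
  rw [gjmsPairing_comm hn (hF.const_smul c) hG, gjmsPairing_smul_right hn c hG hF,
    gjmsPairing_comm hn hG hF]

theorem gjmsPairing_star (hn : n ≠ 0) {k : ℕ} {F G : Sph n → ℂ} (hF : MemFS k F)
    (hG : MemFS k G) :
    gjmsPairing k (star F) (star G) = starRingEnd ℂ (gjmsPairing k F G) := by
  obtain ⟨φ, hφ⟩ := hF.exists_fsConv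
  obtain ⟨ψ, hψ⟩ := hG.exists_fsConv
  refine tendsto_nhds_unique (hφ.star.tendsto_gjmsForm hn hψ.star) ?_
  simp only [fun i => gjmsForm_star k (ψ := ψ i) (hφ.1 i)]
  exact (Complex.continuous_conj.tendsto _).comp (hφ.tendsto_gjmsForm hn hψ)

theorem star_toC (v : Sph n → ℝ) : star (toC v) = toC v := by
  ext ξ
  simp [toC]

theorem gjmsPairing_toC_im (hn : n ≠ 0) {k : ℕ} {v : Sph n → ℝ} (hv : MemFS k (toC v)) :
    (gjmsPairing k (toC v) (toC v)).im = 0 := by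
  have h := gjmsPairing_star hn hv hv
  rw [star_toC] at h
  exact Complex.conj_eq_iff_im.mp h.symm

theorem gjmsPairing_sum_right (hn : n ≠ 0) {k : ℕ} {ι : Type*} (s : Finset ι) {F : Sph n → ℂ}
    {G : ι → Sph n → ℂ} (hF : MemFS k F) (hG : ∀ i, MemFS k (G i)) :
    gjmsPairing k F (∑ i ∈ s, G i) = ∑ i ∈ s, gjmsPairing k F (G i) := by
  classical
  have hmem : ∀ s : Finset ι, MemFS k (∑ i ∈ s, G i) := fun s => by
    refine Finset.sum_induction G (MemFS k) (fun _ _ => MemFS.add) ?_ fun i _ => hG i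
    simpa using hF.const_smul 0
  induction s using Finset.induction_on with
  | empty => simpa using gjmsPairing_smul_right hn 0 hF hF
  | insert i s hi ih =>
    rw [Finset.sum_insert hi, Finset.sum_insert hi, gjmsPairing_add_right hn hF (hG i) (hmem s), ih]

/-! ### Second-order expansion of the constraint -/

/-- The second-order Taylor formula at 1 is obtained by integrating the first-order expansion of the
derivative; near 1 the absolute value plays no role. -/
theorem abs_rpow_sub_isLittleO (p : ℝ) :
    (fun x : ℝ => |x| ^ p - 1 - p * (x - 1) - p * (p - 1) / 2 * (x - 1) ^ 2)
      =o[𝓝 1] fun x => (x - 1) ^ 2 := by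
  have hnhds : 𝓝[Set.Ioi 0] (1 : ℝ) = 𝓝 1 := isOpen_Ioi.nhdsWithin_eq (Set.mem_Ioi.mpr one_pos)
  have h1 : (fun x : ℝ => p * (x ^ (p - 1) - 1 - (x - 1) * (p - 1))) =o[𝓝 1]
      fun x => (x - 1) ^ 1 := by
    have := (Real.hasDerivAt_rpow_const (x := 1) (p := p - 1) (Or.inl one_ne_zero)).isLittleO
    simp only [Real.one_rpow, mul_one, smul_eq_mul] at this
    simpa using this.const_mul_left p
  have h2 := Convex.isLittleO_pow_succ_real (s := Set.Ioi (0 : ℝ)) (x₀ := 1) (n := 1)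
    (f := fun x : ℝ => x ^ p - 1 - p * (x - 1) - p * (p - 1) / 2 * (x - 1) ^ 2)
    (f' := fun x : ℝ => p * (x ^ (p - 1) - 1 - (x - 1) * (p - 1))) (convex_Ioi 0)
    (Set.mem_Ioi.mpr one_pos) (fun x hx => ?_) (by rwa [hnhds])
  · rw [hnhds] at h2
    refine h2.congr' ?_ EventuallyEq.rfl
    filter_upwards [lt_mem_nhds (zero_lt_one' ℝ)] with x hx
    simp [abs_of_pos hx]
  · have d1 := Real.hasDerivAt_rpow_const (x := x) (p := p) (Or.inl (ne_of_gt hx))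
    have d2 := (hasDerivAt_id x).sub_const 1
    refine HasDerivAt.hasDerivWithinAt ?_
    refine (((d1.sub_const 1).sub (d2.const_mul p)).sub
      ((d2.pow 2).const_mul (p * (p - 1) / 2))).congr_deriv ?_
    simp
    ring

variable {α : Type*} [MeasurableSpace α] {μ : Measure α}

theorem integrable_rpow_one_add_mul {w f : α → ℝ} (hw : Integrable w μ)
    (hfm : AEStronglyMeasurable f μ) (hf : ∀ a, |f a| ≤ 1) {p : ℝ} (hp : 0 ≤ p) (t : ℝ) :
    Integrable (fun a => |1 + t * f a| ^ p * w a) μ := by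
  refine hw.bdd_mul (c := (1 + |t|) ^ p) ?_ (Eventually.of_forall fun a => ?_)
  · exact (Real.continuous_rpow_const hp |>.comp continuous_abs).comp_aestronglyMeasurable
      ((hfm.const_mul t).const_add 1)
  · rw [Real.norm_of_nonneg (by positivity)]
    refine Real.rpow_le_rpow (abs_nonneg _) ((abs_add_le _ _).trans ?_) hp
    rw [abs_one, abs_mul]
    exact add_le_add_right (mul_le_of_le_one_right (abs_nonneg t) (hf a)) _

/-- As |f| ≤ 1, the pointwise Taylor remainder at 1 + t f(a) is at most εt² uniformly in a, so
integrating against w is harmless. The linear term vanishes by the orthogonality of f and w. -/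
theorem integral_rpow_one_add_isLittleO {w f : α → ℝ} (hw : Integrable w μ) (hw0 : ∀ a, 0 ≤ w a)
    (hw1 : ∫ a, w a ∂μ = 1) (hfm : AEStronglyMeasurable f μ) (hf : ∀ a, |f a| ≤ 1)
    (hfw : ∫ a, f a * w a ∂μ = 0) {p : ℝ} (hp : 0 ≤ p) :
    (fun t : ℝ => (∫ a, |1 + t * f a| ^ p * w a ∂μ) - 1 -
      p * (p - 1) / 2 * (∫ a, f a ^ 2 * w a ∂μ) * t ^ 2) =o[𝓝 0] fun t => t ^ 2 := by
  rw [Asymptotics.isLittleO_iff]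
  intro ε hε
  have h := (abs_rpow_sub_isLittleO p).def hε
  rw [Metric.eventually_nhds_iff] at h
  obtain ⟨δ, hδ, h⟩ := h
  filter_upwards [Metric.ball_mem_nhds (0 : ℝ) hδ] with t ht
  have ht' : |t| < δ := by simpa using ht
  have i1 : Integrable (fun a => f a * w a) μ := hw.bdd_mul hfm (Eventually.of_forall hf)
  have i2 : Integrable (fun a => f a ^ 2 * w a) μ :=
    hw.bdd_mul (c := 1) (hfm.pow 2) (Eventually.of_forall fun a => by
      rw [norm_pow]
      exact pow_le_one₀ (norm_nonneg _) (hf a))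
  have i0 := integrable_rpow_one_add_mul hw hfm hf hp t
  have e : (∫ a, |1 + t * f a| ^ p * w a ∂μ) - 1 -
      p * (p - 1) / 2 * (∫ a, f a ^ 2 * w a ∂μ) * t ^ 2 =
      ∫ a, (|1 + t * f a| ^ p * w a - w a - p * t * (f a * w a) -
        p * (p - 1) / 2 * t ^ 2 * (f a ^ 2 * w a)) ∂μ := by
    have i3 : Integrable (fun a => |1 + t * f a| ^ p * w a - w a) μ := i0.sub hw
    have i4 : Integrable (fun a => |1 + t * f a| ^ p * w a - w a - p * t * (f a * w a)) μ :=
      i3.sub (i1.const_mul _)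
    rw [integral_sub i4 (i2.const_mul _), integral_sub i3 (i1.const_mul _), integral_sub i0 hw, integral_const_mul,
      integral_const_mul, hw1, hfw]
    ring
  rw [e]
  have hb : ∀ a, ‖|1 + t * f a| ^ p * w a - w a - p * t * (f a * w a) -
        p * (p - 1) / 2 * t ^ 2 * (f a ^ 2 * w a)‖ ≤ ε * t ^ 2 * w a := fun a => by
    have ha := h (y := 1 + t * f a) (by
      rw [Real.dist_eq, add_sub_cancel_left, abs_mul]
      exact (mul_le_of_le_one_right (abs_nonneg t) (hf a)).trans_lt ht')
    rw [add_sub_cancel_left] at ha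
    have e2 : |1 + t * f a| ^ p * w a - w a - p * t * (f a * w a) -
        p * (p - 1) / 2 * t ^ 2 * (f a ^ 2 * w a) = (|1 + t * f a| ^ p - 1 - p * (t * f a) -
          p * (p - 1) / 2 * (t * f a) ^ 2) * w a := by ring
    rw [e2, norm_mul, Real.norm_of_nonneg (hw0 a)]
    refine mul_le_mul_of_nonneg_right (ha.trans ?_) (hw0 a)
    refine mul_le_mul_of_nonneg_left ?_ hε.le
    rw [norm_pow, Real.norm_eq_abs, sq_abs, mul_pow]
    refine mul_le_of_le_one_right (sq_nonneg t) ?_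
    rw [← sq_abs]
    exact pow_le_one₀ (abs_nonneg _) (hf a)
  refine (norm_integral_le_of_norm_le (hw.const_mul _) (Eventually.of_forall hb)).trans ?_
  rw [integral_const_mul, hw1, mul_one, Real.norm_of_nonneg (sq_nonneg t)]

/-- The chain rule multiplies the quadratic coefficient p(p - 1)M/2 by 2/p. -/
theorem tendsto_rpow_sub_one_div_sq {B : ℝ → ℝ} {M p : ℝ} (hp : p ≠ 0)
    (hB : (fun t : ℝ => B t - 1 - p * (p - 1) / 2 * M * t ^ 2) =o[𝓝 0] fun t => t ^ 2) :
    Tendsto B (𝓝 0) (𝓝 1) ∧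
      Tendsto (fun t => (B t ^ (2 / p) - 1) / t ^ 2) (𝓝[≠] 0) (𝓝 ((p - 1) * M)) := by
  have hO : (fun t => B t - 1) =O[𝓝 0] fun t : ℝ => t ^ 2 := by
    have := hB.isBigO.add (Asymptotics.isBigO_const_mul_self (p * (p - 1) / 2 * M)
      (fun t : ℝ => t ^ 2) (𝓝 0))
    simpa using this
  have hlim : Tendsto B (𝓝 0) (𝓝 1) := by
    have h0 : Tendsto (fun t : ℝ => t ^ 2) (𝓝 0) (𝓝 0) := by
      simpa using (continuous_pow 2).tendsto (0 : ℝ)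
    simpa using (hO.trans_tendsto h0).add_const 1
  refine ⟨hlim, ?_⟩
  have h1 := (Real.hasDerivAt_rpow_const (x := 1) (p := 2 / p) (Or.inl one_ne_zero)).isLittleO
  have h2 := (h1.comp_tendsto hlim).trans_isBigO hO
  have h3 : (fun t => B t ^ (2 / p) - 1 - (p - 1) * M * t ^ 2) =o[𝓝 0] fun t : ℝ => t ^ 2 := by
    refine (h2.add (hB.const_mul_left (2 / p))).congr_left fun t => ?_
    simp only [Function.comp_apply, Real.one_rpow, mul_one, smul_eq_mul]
    field_simp
    ring
  have h4 := (h3.mono (nhdsWithin_le_nhds (s := {0}ᶜ))).tendsto_div_nhds_zero.add_const ((p - 1) * M)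
  rw [zero_add] at h4
  refine h4.congr' ?_
  filter_upwards [self_mem_nhdsWithin] with t ht
  have : t ≠ 0 := ht
  field_simp
  ring

/-- Adding the inequalities at t and -t removes the linear term, so the Euler–Lagrange equation is
not needed. Then divide by t² and let t tend to 0. -/
theorem le_of_eventually_rpow_le {B : ℝ → ℝ} {M p A₀ A₁ A₂ : ℝ}
    (hB : Tendsto (fun t => (B t ^ (2 / p) - 1) / t ^ 2) (𝓝[≠] 0) (𝓝 ((p - 1) * M)))
    (h : ∀ᶠ t in 𝓝 0, A₀ * B t ^ (2 / p) ≤ A₀ + 2 * t * A₁ + t ^ 2 * A₂) :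
    (p - 1) * M * A₀ ≤ A₂ := by
  have hneg : Tendsto (fun t : ℝ => -t) (𝓝[≠] 0) (𝓝[≠] 0) := by
    refine tendsto_nhdsWithin_iff.mpr ⟨?_, ?_⟩
    · simpa using (continuous_neg.tendsto (0 : ℝ)).mono_left nhdsWithin_le_nhds
    · filter_upwards [self_mem_nhdsWithin] with t ht
      simpa using ht
  have h' : ∀ᶠ t in 𝓝[≠] (0 : ℝ), A₀ * B t ^ (2 / p) ≤ A₀ + 2 * t * A₁ + t ^ 2 * A₂ :=
    h.filter_mono nhdsWithin_le_nhds
  have hsum := (hB.add (hB.comp hneg)).const_mul A₀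
  have hle : A₀ * ((p - 1) * M + (p - 1) * M) ≤ 2 * A₂ := by
    refine le_of_tendsto hsum ?_
    filter_upwards [h', hneg.eventually h', self_mem_nhdsWithin] with t h1 h2 ht
    have ht2 : 0 < t ^ 2 := by
      have : t ≠ 0 := ht
      positivity
    simp only [Function.comp_apply, neg_sq] at h2 ⊢
    rw [← add_div, mul_div_assoc', div_le_iff₀ ht2]
    linarith
  linarith

/-! ### The second variation at a local minimizer -/

theorem toC_add (v v' : Sph n → ℝ) : toC (v + v') = toC v + toC v' := by
  ext ξ
  simp [toC]

theorem toC_smul (c : ℝ) (v : Sph n → ℝ) : toC (c • v) = (c : ℂ) • toC v := by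
  ext ξ
  simp [toC]

theorem toC_mul (v v' : Sph n → ℝ) : toC (v * v') = toC v * toC v' := by
  ext ξ
  simp [toC]

theorem energy_smul_add (hn : n ≠ 0) {k : ℕ} {u v : Sph n → ℝ} (hu : MemFS k (toC u))
    (hv : MemFS k (toC v)) (c t : ℝ) : energy k (c • (u + t • v)) =
      c ^ 2 * (energy k u + 2 * t * (gjmsPairing k (toC u) (toC v)).re + t ^ 2 * energy k v) := by
  have hv' : MemFS k ((t : ℂ) • toC v) := hv.const_smul _
  have huv := hu.add hv'
  rw [energy, toC_smul, toC_add, toC_smul, gjmsPairing_smul_left hn _ huv (huv.const_smul _),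
    gjmsPairing_smul_right hn _ huv huv, gjmsPairing_add_left hn hu hv' huv,
    gjmsPairing_add_right hn hu hu hv', gjmsPairing_add_right hn hv' hu hv',
    gjmsPairing_smul_right hn _ hu hv, gjmsPairing_smul_left hn _ hv hu,
    gjmsPairing_smul_left hn _ hv hv', gjmsPairing_smul_right hn _ hv hv,
    gjmsPairing_comm hn hv hu]
  simp only [energy, Complex.add_re, Complex.re_ofReal_mul]
  ring

theorem critExp_pos {k : ℕ} (hkn : k < n + 1) : 0 < critExp n k := by
  have : (k : ℝ) < n + 1 := mod_cast hkn
  unfold critExp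
  apply div_pos <;> linarith [Nat.cast_nonneg (α := ℝ) n]

/-- The integral of a non-integrable function is 0 by convention, whereas the constraint is 1. -/
theorem IsLocalMinimizer.integrable {k : ℕ} {u : Sph n → ℝ} (hmin : IsLocalMinimizer k u) :
    Integrable (fun ξ => |u ξ| ^ critExp n k) (vol n) := by
  by_contra h
  have h1 := hmin.2.1
  rw [constraint, integral_undef h] at h1
  exact zero_ne_one h1

/-- The competitor is c(t)(1 + tf)u, normalized by c(t) = B(t)^(-1/p). It tends to u in S^{k,2}, and
its energy is c(t)² times a quadratic polynomial in t. -/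
theorem IsLocalMinimizer.second_variation (hn : n ≠ 0) {k : ℕ} (hkn : k < n + 1) {u : Sph n → ℝ}
    (hmin : IsLocalMinimizer k u) {f : Sph n → ℝ} (hf : IsSmooth (toC f)) (hf1 : ∀ ξ, |f ξ| ≤ 1)
    (hbal : ∫ ξ, f ξ * |u ξ| ^ critExp n k ∂(vol n) = 0) :
    (critExp n k - 1) * (∫ ξ, f ξ ^ 2 * |u ξ| ^ critExp n k ∂(vol n)) * energy k u ≤
      energy k (f * u) := by
  have hint := hmin.integrable
  obtain ⟨hu, hcon, ε, hε, hle⟩ := hmin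
  set p := critExp n k with hp
  have hp0 : 0 < p := critExp_pos hkn
  have hfc : Continuous f := Complex.continuous_re.comp hf.continuous
  have hfu : MemFS k (toC (f * u)) := by
    rw [toC_mul]
    exact hu.smooth_mul hf
  set B : ℝ → ℝ := fun t => ∫ ξ, |1 + t * f ξ| ^ p * |u ξ| ^ p ∂(vol n) with hB
  obtain ⟨hB1, hB2⟩ := tendsto_rpow_sub_one_div_sq hp0.ne'
    (integral_rpow_one_add_isLittleO hint (fun ξ => by positivity) hcon
      hfc.aestronglyMeasurable hf1 hbal hp0.le)
  refine le_of_eventually_rpow_le (A₁ := (gjmsPairing k (toC u) (toC (f * u))).re) hB2 ?_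
  set c : ℝ → ℝ := fun t => B t ^ (-1 / p) with hc
  have hc1 : Tendsto c (𝓝 0) (𝓝 1) := by
    simpa using hB1.rpow_const (p := -1 / p) (Or.inl one_ne_zero)
  have hclose : Tendsto (fun t => ‖((c t - 1 : ℝ) : ℂ)‖ₑ * fsNorm k (toC u) +
      ‖((c t * t : ℝ) : ℂ)‖ₑ * fsNorm k (toC (f * u))) (𝓝 0) (𝓝 0) := by
    have h1 : Tendsto (fun t => ‖((c t - 1 : ℝ) : ℂ)‖ₑ) (𝓝 0) (𝓝 0) := by
      have : Tendsto (fun t => ((c t - 1 : ℝ) : ℂ)) (𝓝 0) (𝓝 0) := by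
        have h := (Complex.continuous_ofReal.tendsto _).comp (hc1.sub_const 1)
        rwa [sub_self, Complex.ofReal_zero] at h
      simpa using this.enorm
    have h2 : Tendsto (fun t => ‖((c t * t : ℝ) : ℂ)‖ₑ) (𝓝 0) (𝓝 0) := by
      have : Tendsto (fun t => ((c t * t : ℝ) : ℂ)) (𝓝 0) (𝓝 0) := by
        have h := (Complex.continuous_ofReal.tendsto _).comp (hc1.mul tendsto_id)
        rwa [mul_zero, Complex.ofReal_zero] at h
      simpa using this.enorm
    simpa using (ENNReal.Tendsto.mul_const h1 (Or.inr hu.fsNorm_ne_top)).add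
      (ENNReal.Tendsto.mul_const h2 (Or.inr hfu.fsNorm_ne_top))
  filter_upwards [hclose.eventually (gt_mem_nhds hε), hB1.eventually (lt_mem_nhds one_pos)]
    with t ht hBt
  have hct : 0 < c t := Real.rpow_pos_of_pos hBt _
  have hmem : MemFS k (toC (c t • (u + t • (f * u)))) := by
    rw [toC_smul, toC_add, toC_smul]
    exact (hu.add (hfu.const_smul _)).const_smul _
  have hcp : c t ^ p * B t = 1 := by
    rw [hc]
    dsimp only
    rw [← Real.rpow_mul hBt.le, div_mul_cancel₀ _ hp0.ne', Real.rpow_neg_one,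
      inv_mul_cancel₀ hBt.ne']
  have hcon' : constraint k (c t • (u + t • (f * u))) = 1 := by
    rw [← hcp, hB]
    dsimp only
    rw [← integral_const_mul]
    refine integral_congr_ae (Eventually.of_forall fun ξ => ?_)
    dsimp only
    rw [← hp, ← Real.mul_rpow (abs_nonneg _) (abs_nonneg _), ← abs_mul,
      ← Real.mul_rpow hct.le (abs_nonneg _), ← abs_of_pos hct, ← abs_mul, abs_of_pos hct]
    congr 2
    simp only [Pi.smul_apply, Pi.add_apply, Pi.mul_apply, smul_eq_mul]
    ring
  have hnorm : fsNorm k (toC (c t • (u + t • (f * u))) - toC u) < ε := by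
    refine lt_of_le_of_lt ?_ ht
    have e : toC (c t • (u + t • (f * u))) - toC u =
        ((c t - 1 : ℝ) : ℂ) • toC u + ((c t * t : ℝ) : ℂ) • toC (f * u) := by
      rw [toC_smul, toC_add, toC_smul]
      push_cast
      module
    rw [e]
    exact (fsNorm_add_le k _ _).trans
      (add_le_add (fsNorm_const_smul_le k _ _) (fsNorm_const_smul_le k _ _))
  have hfin := hle _ hmem hcon' hnorm
  rw [energy_smul_add hn hu hfu] at hfin
  have hc2 : c t ^ 2 * B t ^ (2 / p) = 1 := by
    rw [hc]
    dsimp only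
    rw [← Real.rpow_natCast, ← Real.rpow_mul hBt.le, ← Real.rpow_add hBt]
    have : -1 / p * ((2 : ℕ) : ℝ) + 2 / p = 0 := by
      push_cast
      ring
    rw [this, Real.rpow_zero]
  have hBpos : 0 < B t ^ (2 / p) := Real.rpow_pos_of_pos hBt _
  -- Multiplying by B^(2/p) = c^(-2) clears the normalization from the energy.
  calc energy k u * B t ^ (2 / p) ≤ _ * B t ^ (2 / p) := mul_le_mul_of_nonneg_right hfin hBpos.le
    _ = _ := by
      rw [mul_right_comm, hc2, one_mul]

/-! ### Testing with the coordinate functions -/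

/-- The real part of the coordinate `z_j`. -/
def coordRe (j : Fin (n + 1)) (ξ : Sph n) : ℝ := (coord j ξ).re

/-- The imaginary part of the coordinate `z_j`. -/
def coordIm (j : Fin (n + 1)) (ξ : Sph n) : ℝ := (coord j ξ).im

theorem isSmooth_coordRe (j : Fin (n + 1)) : IsSmooth (toC (coordRe (n := n) j)) := by
  have h : toC (coordRe (n := n) j) = (1 / 2 : ℂ) • (coord j + star (coord j)) := by
    ext ξ
    simp [toC, coordRe, Complex.re_eq_add_conj]
    ring
  rw [h]
  exact ((isSmooth_coord j).add (isSmooth_coord j).star).const_smul _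

theorem isSmooth_coordIm (j : Fin (n + 1)) : IsSmooth (toC (coordIm (n := n) j)) := by
  have h : toC (coordIm (n := n) j) = (1 / (2 * Complex.I) : ℂ) • (coord j - star (coord j)) := by
    ext ξ
    simp [toC, coordIm, Complex.im_eq_sub_conj, div_eq_inv_mul]
  rw [h]
  exact ((isSmooth_coord j).sub (isSmooth_coord j).star).const_smul _

theorem sum_norm_sq_coord (ξ : Sph n) : ∑ j, ‖coord j ξ‖ ^ 2 = 1 := by
  have h := EuclideanSpace.norm_sq_eq (ξ : Amb n)
  rw [mem_sphere_zero_iff_norm.mp ξ.2, one_pow] at h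
  exact h.symm

theorem norm_coord_le (j : Fin (n + 1)) (ξ : Sph n) : ‖coord j ξ‖ ≤ 1 := by
  rw [← sq_le_one_iff₀ (norm_nonneg _), ← sum_norm_sq_coord ξ]
  exact Finset.single_le_sum (f := fun j => ‖coord j ξ‖ ^ 2) (fun _ _ => by positivity)
    (Finset.mem_univ j)

theorem coord_mul_toC (j : Fin (n + 1)) (u : Sph n → ℝ) :
    coord j * toC u = toC (coordRe j * u) + Complex.I • toC (coordIm j * u) := by
  ext ξ
  simp only [Pi.mul_apply, Pi.add_apply, Pi.smul_apply, toC, coordRe, coordIm, smul_eq_mul]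
  conv_lhs => rw [← Complex.re_add_im (coord j ξ)]
  push_cast
  ring

theorem star_coord_mul_toC (j : Fin (n + 1)) (u : Sph n → ℝ) :
    (fun ξ => star (coord j ξ) * (u ξ : ℂ)) =
      toC (coordRe j * u) + (-Complex.I) • toC (coordIm j * u) := by
  ext ξ
  simp only [Pi.mul_apply, Pi.add_apply, Pi.smul_apply, toC, coordRe, coordIm, smul_eq_mul]
  conv_lhs => rw [← Complex.re_add_im (coord j ξ)]
  rw [star_add, star_mul', Complex.star_def,
    Complex.conj_ofReal, Complex.conj_ofReal, Complex.conj_I]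
  push_cast
  ring

/-- Expand z_j = x_j + i y_j in the first slot and z̄_j = x_j - i y_j in the second: the mixed terms
cancel by symmetry. The subtracted terms add up to A(u) because ∑ z_j z̄_j = 1 on the sphere. -/
theorem sum_commPairing (hn : n ≠ 0) {k : ℕ} {u : Sph n → ℝ} (hu : MemFS k (toC u)) :
    ∑ j, commPairing k (coord j) (toC u) (fun ξ => star (coord j ξ) * (u ξ : ℂ)) =
      ∑ j, (gjmsPairing k (toC (coordRe j * u)) (toC (coordRe j * u)) +
        gjmsPairing k (toC (coordIm j * u)) (toC (coordIm j * u))) -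
      gjmsPairing k (toC u) (toC u) := by
  have hX : ∀ j, MemFS k (toC (coordRe j * u)) := fun j => by
    rw [toC_mul]
    exact hu.smooth_mul (isSmooth_coordRe j)
  have hY : ∀ j, MemFS k (toC (coordIm j * u)) := fun j => by
    rw [toC_mul]
    exact hu.smooth_mul (isSmooth_coordIm j)
  have hsum : ∑ j, coord j * (fun ξ => star (coord j ξ) * (u ξ : ℂ)) = toC u := by
    ext ξ
    simp only [Finset.sum_apply, Pi.mul_apply, toC, ← mul_assoc, ← Finset.sum_mul]
    have : ∑ j, coord j ξ * star (coord j ξ) = 1 := by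
      have h := congrArg (fun x : ℝ => (x : ℂ)) (sum_norm_sq_coord ξ)
      simpa [Complex.mul_conj'] using h
    rw [this, one_mul]
  have hmem : ∀ j, MemFS k (coord j * (fun ξ => star (coord j ξ) * (u ξ : ℂ))) := fun j =>
    (hu.smooth_mul (isSmooth_coord j).star).smooth_mul (isSmooth_coord j)
  simp only [commPairing, Finset.sum_sub_distrib]
  rw [← gjmsPairing_sum_right hn _ hu hmem, hsum]
  congr 1
  refine Finset.sum_congr rfl fun j _ => ?_
  have hXY : MemFS k (toC (coordRe j * u) + (-Complex.I) • toC (coordIm j * u)) :=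
    (hX j).add ((hY j).const_smul _)
  rw [coord_mul_toC, star_coord_mul_toC, gjmsPairing_add_left hn (hX j) ((hY j).const_smul _) hXY,
    gjmsPairing_smul_left hn _ (hY j) hXY, gjmsPairing_add_right hn (hX j) (hX j)
    ((hY j).const_smul _), gjmsPairing_add_right hn (hY j) (hX j) ((hY j).const_smul _),
    gjmsPairing_smul_right hn _ (hX j) (hY j), gjmsPairing_smul_right hn _ (hY j) (hY j),
    gjmsPairing_comm hn (hY j) (hX j)]
  linear_combination (-gjmsPairing k (toC (coordIm j * u)) (toC (coordIm j * u))) * Complex.I_mul_I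

theorem IsLocalMinimizer.sum_energy_ge (hn : n ≠ 0) {k : ℕ} (hkn : k < n + 1) {u : Sph n → ℝ}
    (hpos : ∀ᵐ ξ ∂(vol n), 0 < u ξ) (hmin : IsLocalMinimizer k u)
    (hbal : ∀ j : Fin (n + 1),
      ∫ ξ, coord j ξ * ((u ξ ^ critExp n k : ℝ) : ℂ) ∂(vol n) = 0) :
    (critExp n k - 1) * energy k u ≤
      ∑ j, (energy k (coordRe j * u) + energy k (coordIm j * u)) := by
  have hint := hmin.integrable
  have hcon := hmin.2.1
  rw [constraint] at hcon
  have hbal' : ∀ j : Fin (n + 1), Integrable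
      (fun ξ => coord j ξ * ((|u ξ| ^ critExp n k : ℝ) : ℂ)) (vol n) ∧
      ∫ ξ, coord j ξ * ((|u ξ| ^ critExp n k : ℝ) : ℂ) ∂(vol n) = 0 := fun j => by
    refine ⟨hint.ofReal.bdd_mul (isSmooth_coord j).continuous.aestronglyMeasurable
      (Eventually.of_forall (norm_coord_le j)), ?_⟩
    rw [← hbal j]
    refine integral_congr_ae ?_
    filter_upwards [hpos] with ξ hξ
    rw [abs_of_pos hξ]
  have hre : ∀ j : Fin (n + 1), ∫ ξ, coordRe j ξ * |u ξ| ^ critExp n k ∂(vol n) = 0 := fun j => by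
    have h := integral_re (hbal' j).1
    rw [(hbal' j).2] at h
    simpa [coordRe] using h
  have him : ∀ j : Fin (n + 1), ∫ ξ, coordIm j ξ * |u ξ| ^ critExp n k ∂(vol n) = 0 := fun j => by
    have h := integral_im (hbal' j).1
    rw [(hbal' j).2] at h
    simpa [coordIm] using h
  have bre : ∀ (j : Fin (n + 1)) (ξ : Sph n), |coordRe j ξ| ≤ 1 := fun j ξ =>
    (Complex.abs_re_le_norm _).trans (norm_coord_le j ξ)
  have bim : ∀ (j : Fin (n + 1)) (ξ : Sph n), |coordIm j ξ| ≤ 1 := fun j ξ =>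
    (Complex.abs_im_le_norm _).trans (norm_coord_le j ξ)
  have hsq : ∀ {f : Sph n → ℝ}, IsSmooth (toC f) → (∀ ξ, |f ξ| ≤ 1) →
      Integrable (fun ξ => f ξ ^ 2 * |u ξ| ^ critExp n k) (vol n) := fun {f} hf hf1 =>
    hint.bdd_mul (c := 1)
      ((Complex.continuous_re.comp hf.continuous).pow 2).aestronglyMeasurable
      (Eventually.of_forall fun ξ => by
        rw [norm_pow]
        exact pow_le_one₀ (norm_nonneg _) (hf1 ξ))
  have htotal : ∑ j : Fin (n + 1), ((∫ ξ, coordRe j ξ ^ 2 * |u ξ| ^ critExp n k ∂(vol n)) +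
      ∫ ξ, coordIm j ξ ^ 2 * |u ξ| ^ critExp n k ∂(vol n)) = 1 := by
    rw [Finset.sum_add_distrib,
      ← integral_finsetSum _ fun j _ => hsq (isSmooth_coordRe j) (bre j),
      ← integral_finsetSum _ fun j _ => hsq (isSmooth_coordIm j) (bim j),
      ← integral_add (integrable_finsetSum _ fun j _ => hsq (isSmooth_coordRe j) (bre j))
        (integrable_finsetSum _ fun j _ => hsq (isSmooth_coordIm j) (bim j))]
    refine Eq.trans ?_ hcon
    refine integral_congr_ae (Eventually.of_forall fun ξ => ?_)
    dsimp only
    simp only [← Finset.sum_add_distrib, ← add_mul, ← Finset.sum_mul]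
    have : ∑ j, (coordRe j ξ ^ 2 + coordIm j ξ ^ 2) = 1 := by
      rw [← sum_norm_sq_coord ξ]
      refine Finset.sum_congr rfl fun j _ => ?_
      rw [← Complex.normSq_eq_norm_sq, Complex.normSq_apply, coordRe, coordIm]
      ring
    rw [this, one_mul]
  calc (critExp n k - 1) * energy k u
      = ∑ j : Fin (n + 1), ((critExp n k - 1) *
          (∫ ξ, coordRe j ξ ^ 2 * |u ξ| ^ critExp n k ∂(vol n)) * energy k u +
          (critExp n k - 1) *
          (∫ ξ, coordIm j ξ ^ 2 * |u ξ| ^ critExp n k ∂(vol n)) * energy k u) := by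
        simp only [← add_mul, ← mul_add, ← Finset.sum_mul, ← Finset.mul_sum]
        rw [htotal, mul_one]
    _ ≤ _ := Finset.sum_le_sum fun j _ => add_le_add
        (hmin.second_variation hn hkn (isSmooth_coordRe j) (bre j) (hre j))
        (hmin.second_variation hn hkn (isSmooth_coordIm j) (bim j) (him j))

end CRSphere

end

theorem proposition4p3 (n k : ℕ) (hk : 1 ≤ k) (hkn : k < n + 1)
    (u : CRSphere.Sph n → ℝ)
    (hpos : ∀ᵐ ξ ∂(CRSphere.vol n), 0 < u ξ)
    (hmin : CRSphere.IsLocalMinimizer k u)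
    (hbal : ∀ j : Fin (n + 1),
      ∫ ξ, CRSphere.coord j ξ * ((u ξ ^ CRSphere.critExp n k : ℝ) : ℂ) ∂(CRSphere.vol n) = 0) :
    (∑ j : Fin (n + 1), CRSphere.commPairing k (CRSphere.coord j) (CRSphere.toC u)
        (fun ξ => star (CRSphere.coord j ξ) * (u ξ : ℂ))).im = 0 ∧
    (CRSphere.gjmsPairing k (CRSphere.toC u) (CRSphere.toC u)).im = 0 ∧
    (∑ j : Fin (n + 1), CRSphere.commPairing k (CRSphere.coord j) (CRSphere.toC u)
        (fun ξ => star (CRSphere.coord j ξ) * (u ξ : ℂ))).re ≥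
      (CRSphere.critExp n k - 2) *
        (CRSphere.gjmsPairing k (CRSphere.toC u) (CRSphere.toC u)).re := by
  -- From 1 ≤ k < n + 1.
  have hn : n ≠ 0 := by omega
  have hu := hmin.1
  have him := CRSphere.gjmsPairing_toC_im hn hu
  have hmul : ∀ f : CRSphere.Sph n → ℝ, CRSphere.IsSmooth (CRSphere.toC f) →
      (CRSphere.gjmsPairing k (CRSphere.toC (f * u)) (CRSphere.toC (f * u))).im = 0 :=
    fun f hf => by
      refine CRSphere.gjmsPairing_toC_im hn ?_
      rw [CRSphere.toC_mul]
      exact hu.smooth_mul hf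
  rw [CRSphere.sum_commPairing hn hu]
  refine ⟨?_, him, ?_⟩
  · rw [Complex.sub_im, Complex.im_sum, him, sub_zero]
    refine Finset.sum_eq_zero fun j _ => ?_
    rw [Complex.add_im, hmul _ (CRSphere.isSmooth_coordRe j), hmul _ (CRSphere.isSmooth_coordIm j),
      add_zero]
  · have h := hmin.sum_energy_ge hn hkn hpos hbal
    rw [Complex.sub_re, Complex.re_sum]
    simp only [Complex.add_re]
    simp only [CRSphere.energy] at h
    linarith
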